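/- Let $k$ be a field of characteristic zero and let $X=GM$ be a finite group factorization, i.e. $G,M\le X$ are subgroups such that the product map $G\times M\to X$ is bijective. For $s\in M$, $u\in G$ define $s\triangleright u\in G$ and $s\triangleleft u\in M$ by $su=(s\triangleright u)(s\triangleleft u)$. Let $A=k(M)\blacktriangleright\!\!\triangleleft\, kG$ be the bicrossproduct Hopf algebra with basis $\delta_s\otimes u$ $(s\in M,u\in G)$, $$(\delta_s\otimes u)(\delta_t\otimes v)=\delta_{s\triangleleft u,t}\,\delta_s\otimes uv,\quad \Delta(\delta_s\otimes u)=\sum_{ab=s}\delta_a\otimes (b\triangleright u)\otimes\delta_b\otimes u,$$ $$1=\sum_s\delta_s\otimes e,\quad \varepsilon(\delta_s\otimes u)=\delta_{s,e},\quad S(\delta_s\otimes u)=\delta_{(s\triangleleft u)^{-1}}\otimes(s\triangleright u)^{-1},$$ and let $H=A^*=kM\triangleright\!\!\blacktriangleleft k(G)$ be its dual, with dual basis $s\otimes\delta_u$. The quantum double $D(H)=H^{*\mathrm{op}}\bowtie H$ acts canonically from the right on $H^+=\ker\varepsilon\subset H$: $H$ acts by $g\triangleleft h=S(h_{(1)})\,g\,h_{(2)}$,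 and $a\in A=H^*$ acts by $a\triangleright h=h_{(1)}\langle h_{(2)},a\rangle-\langle a,h\rangle 1$. A quantum tangent space is a subspace $L\subseteq H^+$ stable under both actions; its dual $\Lambda^1=L^*$, the space of invariant 1-forms, carries the adjoint left action of $D(H)$, and the induced braiding of $\Lambda^1$ is $$\Psi(x\otimes y)=\sum_i \beta^i\triangleright y\otimes x\triangleleft\alpha_i,$$ where $(\alpha_i)$ is a basis of $A$ with dual basis $(\beta^i)$ of $H$, $(\beta\triangleright y)(l)=y(l\triangleleft\beta)$ and $(x\triangleleft\alpha)(l)=x(\alpha\triangleright l)$; i.e. it is given by the universal $R$-matrix $\sum_i(\alpha_i\otimes1)\otimes(1\otimes\beta^i)$ of $D(H)$ followed by the flip. For $v,u\in G$, $t,s\in M$ put $\|vt\|=v^{-1}t^{-1}v$ and $$vt\,\tilde\triangleleft\, us=(\tilde s\triangleright vu)(\tilde s t\tilde s^{-1}),\qquad \tilde s=s^{-1}\triangleleft(vu)^{-1},$$ and extend $\tilde\triangleleft$ linearly to a right action of $X$ on $kX$. Let $\Pi:kX\to H^+$ be the linear map $\Pi(vt)=t\otimes\delta_v-\delta_{v,e}1$.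 Let $z_0\in\{\|x\|:x\in X\}$, let $C$ be its conjugacy class in $X$, let $J_{z_0}=\mathrm{span}_k\{x:\|x\|=z_0\}$, and let $\mathcal M_0\subseteq J_{z_0}$ be an irreducible subrepresentation under the centralizer of $z_0$ in $X$, which is not the trivial representation if $z_0=e$. For each $z\in C$ choose $\bar z\in X$ with $z=\bar z^{-1}z_0\bar z$, and let $\mathcal M=\sum_{z\in C}\mathcal M_0\,\tilde\triangleleft\,\bar z\subseteq kX$ and $L=\Pi(\mathcal M)$. Let $(f_i)_{i\in I}$ be a basis of $\mathcal M_0$ and set $f_{iz}=f_i\,\tilde\triangleleft\,\bar z$ for $a=(i,z)\in I\times C$. Then $\mathcal M$ is stable under $\tilde\triangleleft$; $\Pi$ restricts to a bijection $\mathcal M\to L$; $L$ is a quantum tangent space; and the vectors $f_a$, $a=(i,z)$, form a basis of $\mathcal M$, with $f_{iz}$ homogeneous of $X$-degree $\|f_{iz}\|=z$. Write $\|f_a\|=\langle f_a\rangle^{-1}|f_a|$ with $\langle f_a\rangle\in M$, $|f_a|\in G$, let $(e_a)$ be the basis of $\Lambda^1=L^*$ dual to $(f_a)$ (identifying $\mathcal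 M$ with $L$ by $\Pi$), and let $e_a*x=\sum_b\langle e_a,f_b\,\tilde\triangleleft\,x^{-1}\rangle e_b$ be the right action of $X$ on $\Lambda^1$ adjoint to the left action $x*f=f\,\tilde\triangleleft\,x^{-1}$. The braiding of $\Lambda^1$ induced by the action of the quantum double $D(A^*)=D(H)$ is given, for all $a,b\in I\times C$, by $$\Psi(e_a\otimes e_b)=e_b*(\langle f_a\rangle\triangleleft|f_b|)^{-1}\otimes e_a*|f_b| .$$ -/

import Mathlib

open scoped TensorProduct

namespace Bicross

/-! ### Finite group factorizations -/

/-- A factorization `X = GM` of a group into two subgroups: the product map `G × M → X` is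
bijective. -/
structure Factorization (X : Type*) [Group X] where
  /-- The left factor. -/
  G : Subgroup X
  /-- The right factor. -/
  M : Subgroup X
  /-- Every element of `X` is uniquely of the form `u * s` with `u ∈ G`, `s ∈ M`. -/
  isCompl : G.IsComplement' M

namespace Factorization

variable {X : Type*} [Group X] (F : Factorization X)

noncomputable instance instFintypeG [Finite X] : Fintype F.G := Fintype.ofFinite _

noncomputable instance instFintypeM [Finite X] : Fintype F.M := Fintype.ofFinite _

/-- The component `u` of `x = u * s` with `u ∈ G`, `s ∈ M`. -/
noncomputable def gPart (x : X) : F.G := (Subgroup.IsComplement.equiv F.isCompl x).1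

/-- The component `s` of `x = u * s` with `u ∈ G`, `s ∈ M`. -/
noncomputable def mPart (x : X) : F.M := (Subgroup.IsComplement.equiv F.isCompl x).2

theorem gPart_mul_mPart (x : X) : (F.gPart x : X) * (F.mPart x : X) = x :=
  F.isCompl.equiv_fst_mul_equiv_snd x

theorem parts_eq {x : X} {u : F.G} {s : F.M} (h : (u : X) * (s : X) = x) :
    F.gPart x = u ∧ F.mPart x = s := by
  have h1 : F.isCompl.equiv x = (u, s) := by
    rw [← h]
    exact F.isCompl.equiv.apply_symm_apply (u, s)
  exact ⟨congrArg Prod.fst h1, congrArg Prod.snd h1⟩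

/-- The left action `s ▷ u` of `M` on the set `G`, defined by `s * u = (s ▷ u) * (s ◁ u)`. -/
noncomputable def lact (s : F.M) (u : F.G) : F.G := F.gPart ((s : X) * (u : X))

/-- The right action `s ◁ u` of `G` on the set `M`, defined by `s * u = (s ▷ u) * (s ◁ u)`. -/
noncomputable def ract (s : F.M) (u : F.G) : F.M := F.mPart ((s : X) * (u : X))

theorem lact_mul_ract (s : F.M) (u : F.G) :
    (F.lact s u : X) * (F.ract s u : X) = (s : X) * (u : X) :=
  F.gPart_mul_mPart _

theorem act_eq {s : F.M} {u v : F.G} {t : F.M} (h : (v : X) * (t : X) = (s : X) * (u : X)) :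
    F.lact s u = v ∧ F.ract s u = t :=
  F.parts_eq h

theorem act_one_right (s : F.M) : F.lact s 1 = 1 ∧ F.ract s 1 = s :=
  F.act_eq (by simp)

theorem act_one_left (u : F.G) : F.lact 1 u = u ∧ F.ract 1 u = 1 :=
  F.act_eq (by simp)

theorem act_mul_right (s : F.M) (u v : F.G) :
    F.lact s (u * v) = F.lact s u * F.lact (F.ract s u) v ∧
      F.ract s (u * v) = F.ract (F.ract s u) v :=
  F.act_eq (by
    push_cast
    rw [mul_assoc, lact_mul_ract, ← mul_assoc, lact_mul_ract, mul_assoc])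

theorem act_mul_left (s t : F.M) (u : F.G) :
    F.lact (s * t) u = F.lact s (F.lact t u) ∧
      F.ract (s * t) u = F.ract s (F.lact t u) * F.ract t u :=
  F.act_eq (by
    push_cast
    rw [← mul_assoc, lact_mul_ract, mul_assoc, lact_mul_ract, ← mul_assoc])

theorem ract_eq_one_iff (s : F.M) (u : F.G) : F.ract s u = 1 ↔ s = 1 := by
  constructor
  · intro h
    have h1 := (F.act_mul_right s u u⁻¹).2
    rw [h, mul_inv_cancel, (F.act_one_right s).2, (F.act_one_left _).2] at h1
    exact h1
  · rintro rfl
    exact (F.act_one_left u).2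

theorem lact_eq_one_iff (s : F.M) (u : F.G) : F.lact s u = 1 ↔ u = 1 := by
  constructor
  · intro h
    have h1 := (F.act_mul_left s⁻¹ s u).1
    rw [h, inv_mul_cancel, (F.act_one_right _).1, (F.act_one_left _).1] at h1
    exact h1
  · rintro rfl
    exact (F.act_one_right s).1

/-- The bijection `s ↦ s ◁ u` of `M`. -/
noncomputable def ractEquiv (u : F.G) : F.M ≃ F.M where
  toFun s := F.ract s u
  invFun s := F.ract s u⁻¹
  left_inv s := by
    change F.ract (F.ract s u) u⁻¹ = s
    rw [← (F.act_mul_right s u u⁻¹).2, mul_inv_cancel, (F.act_one_right s).2]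
  right_inv s := by
    change F.ract (F.ract s u⁻¹) u = s
    rw [← (F.act_mul_right s u⁻¹ u).2, inv_mul_cancel, (F.act_one_right s).2]

/-- The bijection `u ↦ s ▷ u` of `G`. -/
noncomputable def lactEquiv (s : F.M) : F.G ≃ F.G where
  toFun u := F.lact s u
  invFun u := F.lact s⁻¹ u
  left_inv u := by
    change F.lact s⁻¹ (F.lact s u) = u
    rw [← (F.act_mul_left s⁻¹ s u).1, inv_mul_cancel, (F.act_one_left u).1]
  right_inv u := by
    change F.lact s (F.lact s⁻¹ u) = u
    rw [← (F.act_mul_left s s⁻¹ u).1, mul_inv_cancel, (F.act_one_left u).1]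

theorem act_inv (s : F.M) (u : F.G) :
    F.lact (F.ract s u)⁻¹ (F.lact s u)⁻¹ = u⁻¹ ∧ F.ract (F.ract s u)⁻¹ (F.lact s u)⁻¹ = s⁻¹ :=
  F.act_eq (by
    push_cast
    rw [← mul_inv_rev, ← mul_inv_rev, lact_mul_ract])

end Factorization

variable (k : Type*) [Field k] {X : Type*} [Group X]

/-! ### The bicrossproduct Hopf algebra `A = k(M) ▸◁ kG` -/

/-- The vector space with basis `δ_s ⊗ u`, for `s ∈ M` and `u ∈ G`. -/
def CoordAlg (F : Factorization X) : Type _ := (F.M × F.G) →₀ k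

namespace CoordAlg

variable (F : Factorization X)

noncomputable instance : AddCommGroup (CoordAlg k F) :=
  inferInstanceAs (AddCommGroup ((F.M × F.G) →₀ k))

noncomputable instance : Module k (CoordAlg k F) :=
  inferInstanceAs (Module k ((F.M × F.G) →₀ k))

/-- The basis `δ_s ⊗ u`, indexed by the pairs `(s, u)`. -/
noncomputable def basis : Module.Basis (F.M × F.G) k (CoordAlg k F) :=
  Module.Basis.ofRepr (LinearEquiv.refl k ((F.M × F.G) →₀ k))

/-- The basis element `δ_s ⊗ u`. -/
noncomputable def of (s : F.M) (u : F.G) : CoordAlg k F := basis k F (s, u)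

open Classical in
/-- The product `(δ_s ⊗ u)(δ_t ⊗ v) = δ_{s ◁ u, t} (δ_s ⊗ u v)`. -/
noncomputable def mulMap : CoordAlg k F →ₗ[k] CoordAlg k F →ₗ[k] CoordAlg k F :=
  (basis k F).constr k fun p => (basis k F).constr k fun q =>
    if F.ract p.1 p.2 = q.1 then of k F p.1 (p.2 * q.2) else 0

noncomputable instance : Mul (CoordAlg k F) := ⟨fun a b => mulMap k F a b⟩

/-- The unit `1 = ∑ s, δ_s ⊗ e`. -/
noncomputable instance [Finite X] : One (CoordAlg k F) := ⟨∑ s : F.M, of k F s 1⟩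

/-- The coproduct `Δ(δ_s ⊗ u) = ∑_{ab = s} (δ_a ⊗ b ▷ u) ⊗ (δ_b ⊗ u)`, where `a = s b⁻¹`. -/
noncomputable def comulMap [Finite X] : CoordAlg k F →ₗ[k] CoordAlg k F ⊗[k] CoordAlg k F :=
  (basis k F).constr k fun p =>
    ∑ b : F.M, of k F (p.1 * b⁻¹) (F.lact b p.2) ⊗ₜ[k] of k F b p.2

open Classical in
/-- The counit `ε(δ_s ⊗ u) = δ_{s,e}`. -/
noncomputable def counitMap : CoordAlg k F →ₗ[k] k :=
  (basis k F).constr k fun p => if p.1 = 1 then 1 else 0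

/-- The antipode `S(δ_s ⊗ u) = δ_{(s ◁ u)⁻¹} ⊗ (s ▷ u)⁻¹`. -/
noncomputable def antipodeMap : CoordAlg k F →ₗ[k] CoordAlg k F :=
  (basis k F).constr k fun p => of k F (F.ract p.1 p.2)⁻¹ (F.lact p.1 p.2)⁻¹

open Classical in
theorem of_mul_of (s t : F.M) (u v : F.G) :
    of k F s u * of k F t v = if F.ract s u = t then of k F s (u * v) else 0 := by
  change mulMap k F (of k F s u) (of k F t v) = _
  simp [mulMap, of]

theorem one_def [Finite X] : (1 : CoordAlg k F) = ∑ s : F.M, of k F s 1 := rfl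

theorem comulMap_of [Finite X] (s : F.M) (u : F.G) :
    comulMap k F (of k F s u) =
      ∑ b : F.M, of k F (s * b⁻¹) (F.lact b u) ⊗ₜ[k] of k F b u := by
  simp only [comulMap, of, Module.Basis.constr_basis]

open Classical in
theorem counitMap_of (s : F.M) (u : F.G) :
    counitMap k F (of k F s u) = if s = 1 then 1 else 0 := by
  simp only [counitMap, of, Module.Basis.constr_basis]

theorem antipodeMap_of (s : F.M) (u : F.G) :
    antipodeMap k F (of k F s u) = of k F (F.ract s u)⁻¹ (F.lact s u)⁻¹ := by
  simp only [antipodeMap, of, Module.Basis.constr_basis]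

variable {k F} in
theorem hom_ext {V : Type*} [AddCommMonoid V] [Module k V] {f g : CoordAlg k F →ₗ[k] V}
    (h : ∀ s u, f (of k F s u) = g (of k F s u)) : f = g :=
  (basis k F).ext fun p => h p.1 p.2

variable {k F} in
theorem induction {p : CoordAlg k F → Prop} (h_of : ∀ s u, p (of k F s u))
    (h_add : ∀ a b, p a → p b → p (a + b)) (h_smul : ∀ (r : k) a, p a → p (r • a))
    (a : CoordAlg k F) : p a := by
  have ha : a ∈ Submodule.span k (Set.range (basis k F)) := by
    rw [(basis k F).span_eq]
    trivial
  induction ha using Submodule.span_induction with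
  | mem x hx =>
    obtain ⟨q, rfl⟩ := hx
    exact h_of q.1 q.2
  | zero => simpa using h_smul 0 _ (h_of 1 1)
  | add x y _ _ hx hy => exact h_add x y hx hy
  | smul r x _ hx => exact h_smul r x hx

theorem mul_def (a b : CoordAlg k F) : a * b = mulMap k F a b := rfl

theorem mulMap_of (s t : F.M) (u v : F.G) :
    mulMap k F (of k F s u) (of k F t v) = of k F s u * of k F t v := rfl

theorem assoc_of (s t r : F.M) (u v w : F.G) :
    of k F s u * of k F t v * of k F r w = of k F s u * (of k F t v * of k F r w) := by
  classical
  have h0 : ∀ a : CoordAlg k F, a * 0 = 0 := fun a => map_zero (mulMap k F a)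
  have h0' : ∀ a : CoordAlg k F, 0 * a = 0 := fun a => by simp [mul_def]
  rw [of_mul_of, of_mul_of]
  by_cases h1 : F.ract s u = t
  · subst h1
    by_cases h2 : F.ract (F.ract s u) v = r
    · simp [of_mul_of, h2, (F.act_mul_right s u v).2, mul_assoc]
    · simp [of_mul_of, h2, (F.act_mul_right s u v).2, h0]
  · by_cases h2 : F.ract t v = r
    · simp [of_mul_of, h1, h2, h0']
    · simp [h1, h2, h0, h0']

theorem mulMap_assoc (a b c : CoordAlg k F) : a * b * c = a * (b * c) := by
  simp only [mul_def]
  induction a using induction with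
  | h_add a a' h h' => simp only [map_add, LinearMap.add_apply, h, h']
  | h_smul x a h => simp only [map_smul, LinearMap.smul_apply, h]
  | h_of s u =>
    induction b using induction with
    | h_add a a' h h' => simp only [map_add, LinearMap.add_apply, h, h']
    | h_smul x a h => simp only [map_smul, LinearMap.smul_apply, h]
    | h_of t v =>
      induction c using induction with
      | h_add a a' h h' => simp only [map_add, h, h']
      | h_smul x a h => simp only [map_smul, h]
      | h_of r w => exact assoc_of k F s t r u v w

theorem one_mulMap [Finite X] (a : CoordAlg k F) : 1 * a = a := by
  classical
  simp only [mul_def]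
  induction a using induction with
  | h_add a a' h h' => simp only [map_add, h, h']
  | h_smul x a h => simp only [map_smul, h]
  | h_of s u =>
    simp [one_def, mulMap_of, of_mul_of, (F.act_one_right _).2]

theorem mulMap_one [Finite X] (a : CoordAlg k F) : a * 1 = a := by
  classical
  simp only [mul_def]
  induction a using induction with
  | h_add a a' h h' => simp only [map_add, LinearMap.add_apply, h, h']
  | h_smul x a h => simp only [map_smul, LinearMap.smul_apply, h]
  | h_of s u => simp [one_def, mulMap_of, of_mul_of]

noncomputable instance [Finite X] : Ring (CoordAlg k F) :=
  { (inferInstance : AddCommGroup (CoordAlg k F)),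
    (inferInstance : Mul (CoordAlg k F)), (inferInstance : One (CoordAlg k F)) with
    left_distrib := fun a b c => map_add (mulMap k F a) b c
    right_distrib := fun a b c => by simp [mul_def]
    zero_mul := fun a => by simp [mul_def]
    mul_zero := fun a => map_zero (mulMap k F a)
    mul_assoc := mulMap_assoc k F
    one_mul := one_mulMap k F
    mul_one := mulMap_one k F }

noncomputable instance [Finite X] : Algebra k (CoordAlg k F) :=
  Algebra.ofModule (fun r a b => by simp [mul_def]) (fun r a b => by simp [mul_def])

noncomputable instance [Finite X] : Coalgebra k (CoordAlg k F) where
  comul := comulMap k F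
  counit := counitMap k F
  coassoc := hom_ext fun s u => by
    simp only [LinearMap.comp_apply, comulMap_of, map_sum, LinearMap.rTensor_tmul,
      LinearMap.lTensor_tmul, TensorProduct.sum_tmul, TensorProduct.tmul_sum,
      LinearEquiv.coe_coe, TensorProduct.assoc_tmul]
    conv_rhs => rw [Finset.sum_comm]
    refine Finset.sum_congr rfl fun c _ => ?_
    refine Fintype.sum_equiv (Equiv.mulRight c) _ _ fun b => ?_
    simp [(F.act_mul_left _ _ _).1, mul_assoc]
  rTensor_counit_comp_comul := hom_ext fun s u => by
    simp only [LinearMap.comp_apply, comulMap_of, map_sum, LinearMap.rTensor_tmul,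
      counitMap_of]
    rw [Finset.sum_eq_single s]
    · simp
    · intro b _ hb
      rw [if_neg (fun h => hb (mul_inv_eq_one.mp h).symm), TensorProduct.zero_tmul]
    · simp
  lTensor_counit_comp_comul := hom_ext fun s u => by
    simp only [LinearMap.comp_apply, comulMap_of, map_sum, LinearMap.lTensor_tmul,
      counitMap_of]
    rw [Finset.sum_eq_single 1]
    · simp [(F.act_one_left u).1]
    · intro b _ hb
      rw [if_neg hb, TensorProduct.tmul_zero]
    · simp

theorem comul_of [Finite X] (s : F.M) (u : F.G) :
    Coalgebra.comul (R := k) (of k F s u) =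
      ∑ b : F.M, of k F (s * b⁻¹) (F.lact b u) ⊗ₜ[k] of k F b u :=
  comulMap_of k F s u

open Classical in
theorem counit_of [Finite X] (s : F.M) (u : F.G) :
    Coalgebra.counit (R := k) (of k F s u) = if s = 1 then 1 else 0 :=
  counitMap_of k F s u

theorem comul_one' [Finite X] :
    Coalgebra.comul (R := k) (1 : CoordAlg k F) = 1 := by
  rw [one_def, map_sum]
  simp only [comul_of, (F.act_one_right _).1]
  rw [Finset.sum_comm, Algebra.TensorProduct.one_def, one_def, TensorProduct.sum_tmul]
  simp only [TensorProduct.tmul_sum]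
  conv_rhs => rw [Finset.sum_comm]
  refine Finset.sum_congr rfl fun b _ => ?_
  exact Fintype.sum_equiv (Equiv.mulRight b⁻¹) _ _ fun a => rfl

theorem comul_mul_of [Finite X] (s t : F.M) (u v : F.G) :
    Coalgebra.comul (R := k) (of k F s u * of k F t v) =
      Coalgebra.comul (R := k) (of k F s u) * Coalgebra.comul (R := k) (of k F t v) := by
  classical
  rw [of_mul_of, comul_of, comul_of, Finset.sum_mul_sum]
  simp only [Algebra.TensorProduct.tmul_mul_tmul, of_mul_of]
  have h : ∀ b : F.M, F.ract (s * b⁻¹) (F.lact b u) * F.ract b u = F.ract s u := fun b => by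
    rw [← (F.act_mul_left (s * b⁻¹) b u).2, inv_mul_cancel_right]
  have key : ∀ b : F.M, (∑ c : F.M,
      (if F.ract (s * b⁻¹) (F.lact b u) = t * c⁻¹ then
        of k F (s * b⁻¹) (F.lact b u * F.lact c v) else 0) ⊗ₜ[k]
      (if F.ract b u = c then of k F b (u * v) else 0)) =
      if F.ract s u = t then of k F (s * b⁻¹) (F.lact b (u * v)) ⊗ₜ[k] of k F b (u * v)
      else 0 := fun b => by
    rw [Finset.sum_eq_single (F.ract b u)]
    · by_cases hst : F.ract s u = t
      · rw [if_pos hst, if_pos rfl, if_pos (eq_mul_inv_of_mul_eq ((h b).trans hst)),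
          (F.act_mul_right b u v).1]
      · rw [if_neg hst, if_neg (fun hh => hst ((h b).symm.trans (eq_mul_inv_iff_mul_eq.mp hh))),
          TensorProduct.zero_tmul]
    · intro c _ hc
      rw [if_neg (Ne.symm hc), TensorProduct.tmul_zero]
    · simp
  rw [Finset.sum_congr rfl fun b _ => key b]
  by_cases hst : F.ract s u = t
  · simp only [if_pos hst, comul_of]
  · simp [if_neg hst]

theorem counit_mul_of [Finite X] (s t : F.M) (u v : F.G) :
    Coalgebra.counit (R := k) (of k F s u * of k F t v) =
      Coalgebra.counit (R := k) (of k F s u) * Coalgebra.counit (R := k) (of k F t v) := by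
  classical
  rw [of_mul_of, counit_of, counit_of]
  by_cases hs : s = 1
  · subst hs
    rw [(F.act_one_left u).2]
    by_cases ht : t = 1
    · simp [ht, counit_of]
    · simp [ht, Ne.symm ht]
  · by_cases h : F.ract s u = t <;> simp [h, hs, counit_of]

noncomputable instance [Finite X] : Bialgebra k (CoordAlg k F) where
  counit_one := by
    classical
    simp [one_def, counit_of]
  mul_compr₂_counit := hom_ext fun s u => hom_ext fun t v => counit_mul_of k F s t u v
  comul_one := comul_one' k F
  mul_compr₂_comul := hom_ext fun s u => hom_ext fun t v => comul_mul_of k F s t u v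

/-- The bicrossproduct Hopf algebra `A = k(M) ▸◁ kG`. -/
noncomputable instance [Finite X] : HopfAlgebra k (CoordAlg k F) where
  antipode := antipodeMap k F
  mul_antipode_rTensor_comul := hom_ext fun s u => by
    classical
    simp only [LinearMap.comp_apply, comul_of, map_sum, LinearMap.rTensor_tmul,
      antipodeMap_of, LinearMap.mul'_apply, of_mul_of, counit_of]
    have h : ∀ b : F.M, F.ract (F.ract (s * b⁻¹) (F.lact b u))⁻¹
        (F.lact (s * b⁻¹) (F.lact b u))⁻¹ = b ↔ s = 1 := fun b => by
      rw [(F.act_inv _ _).2]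
      simp
    simp only [h]
    by_cases hs : s = 1
    · subst hs
      simp only [if_true, Algebra.linearMap_apply, map_one]
      rw [one_def]
      refine Fintype.sum_equiv (F.ractEquiv u) _ _ fun b => ?_
      have h1 := F.act_mul_left b⁻¹ b u
      rw [inv_mul_cancel, (F.act_one_left u).1, (F.act_one_left u).2] at h1
      rw [one_mul, ← h1.1, inv_mul_cancel, inv_eq_of_mul_eq_one_right h1.2.symm]
      rfl
    · simp [hs]
  mul_antipode_lTensor_comul := hom_ext fun s u => by
    classical
    simp only [LinearMap.comp_apply, comul_of, map_sum, LinearMap.lTensor_tmul,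
      antipodeMap_of, LinearMap.mul'_apply, of_mul_of, counit_of]
    have h : ∀ b : F.M, F.ract (s * b⁻¹) (F.lact b u) = (F.ract b u)⁻¹ ↔ s = 1 := fun b => by
      rw [eq_inv_iff_mul_eq_one, ← (F.act_mul_left (s * b⁻¹) b u).2, inv_mul_cancel_right,
        F.ract_eq_one_iff]
    simp only [h, mul_inv_cancel]
    by_cases hs : s = 1
    · subst hs
      simp only [if_true, Algebra.linearMap_apply, map_one, one_mul]
      rw [one_def]
      exact Fintype.sum_equiv (Equiv.inv F.M) _ _ fun b => rfl
    · simp [hs]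

end CoordAlg

/-! ### The bicrossproduct Hopf algebra `H = kM ▷◂ k(G)` -/

/-- The vector space with basis `s ⊗ δ_u`, for `s ∈ M` and `u ∈ G`. -/
def DualAlg (F : Factorization X) : Type _ := (F.M × F.G) →₀ k

namespace DualAlg

variable (F : Factorization X)

noncomputable instance : AddCommGroup (DualAlg k F) :=
  inferInstanceAs (AddCommGroup ((F.M × F.G) →₀ k))

noncomputable instance : Module k (DualAlg k F) :=
  inferInstanceAs (Module k ((F.M × F.G) →₀ k))

/-- The basis `s ⊗ δ_u`, indexed by the pairs `(s, u)`. -/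
noncomputable def basis : Module.Basis (F.M × F.G) k (DualAlg k F) :=
  Module.Basis.ofRepr (LinearEquiv.refl k ((F.M × F.G) →₀ k))

/-- The basis element `s ⊗ δ_u`. -/
noncomputable def of (s : F.M) (u : F.G) : DualAlg k F := basis k F (s, u)

open Classical in
open Classical in
/-- The product `(s ⊗ δ_u) (t ⊗ δ_v) = δ_{u, t ▷ v} (s t ⊗ δ_v)`. -/
noncomputable def mulMap : DualAlg k F →ₗ[k] DualAlg k F →ₗ[k] DualAlg k F :=
  (basis k F).constr k fun p => (basis k F).constr k fun q =>
    if p.2 = F.lact q.1 q.2 then of k F (p.1 * q.1) q.2 else 0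

noncomputable instance : Mul (DualAlg k F) := ⟨fun a b => mulMap k F a b⟩

/-- The unit `1 = ∑ u, e ⊗ δ_u`. -/
noncomputable instance [Finite X] : One (DualAlg k F) := ⟨∑ u : F.G, of k F 1 u⟩

/-- The coproduct `Δ(s ⊗ δ_u) = ∑_{xy = u} (s ⊗ δ_x) ⊗ (s ◁ x ⊗ δ_y)`, where `y = x⁻¹ u`. -/
noncomputable def comulMap [Finite X] : DualAlg k F →ₗ[k] DualAlg k F ⊗[k] DualAlg k F :=
  (basis k F).constr k fun p =>
    ∑ x : F.G, of k F p.1 x ⊗ₜ[k] of k F (F.ract p.1 x) (x⁻¹ * p.2)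

open Classical in
/-- The counit `ε(s ⊗ δ_u) = δ_{u,e}`. -/
noncomputable def counitMap : DualAlg k F →ₗ[k] k :=
  (basis k F).constr k fun p => if p.2 = 1 then 1 else 0

/-- The antipode `S(s ⊗ δ_u) = (s ◁ u)⁻¹ ⊗ δ_{(s ▷ u)⁻¹}`. -/
noncomputable def antipodeMap : DualAlg k F →ₗ[k] DualAlg k F :=
  (basis k F).constr k fun p => of k F (F.ract p.1 p.2)⁻¹ (F.lact p.1 p.2)⁻¹

open Classical in
theorem of_mul_of (s t : F.M) (u v : F.G) :
    of k F s u * of k F t v = if u = F.lact t v then of k F (s * t) v else 0 := by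
  change mulMap k F (of k F s u) (of k F t v) = _
  simp [mulMap, of]

theorem one_def [Finite X] : (1 : DualAlg k F) = ∑ u : F.G, of k F 1 u := rfl

theorem comulMap_of [Finite X] (s : F.M) (u : F.G) :
    comulMap k F (of k F s u) =
      ∑ x : F.G, of k F s x ⊗ₜ[k] of k F (F.ract s x) (x⁻¹ * u) := by
  simp only [comulMap, of, Module.Basis.constr_basis]

open Classical in
theorem counitMap_of (s : F.M) (u : F.G) :
    counitMap k F (of k F s u) = if u = 1 then 1 else 0 := by
  simp only [counitMap, of, Module.Basis.constr_basis]

theorem antipodeMap_of (s : F.M) (u : F.G) :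
    antipodeMap k F (of k F s u) = of k F (F.ract s u)⁻¹ (F.lact s u)⁻¹ := by
  simp only [antipodeMap, of, Module.Basis.constr_basis]

variable {k F} in
theorem hom_ext {V : Type*} [AddCommMonoid V] [Module k V] {f g : DualAlg k F →ₗ[k] V}
    (h : ∀ s u, f (of k F s u) = g (of k F s u)) : f = g :=
  (basis k F).ext fun p => h p.1 p.2

variable {k F} in
theorem induction {p : DualAlg k F → Prop} (h_of : ∀ s u, p (of k F s u))
    (h_add : ∀ a b, p a → p b → p (a + b)) (h_smul : ∀ (r : k) a, p a → p (r • a))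
    (a : DualAlg k F) : p a := by
  have ha : a ∈ Submodule.span k (Set.range (basis k F)) := by
    rw [(basis k F).span_eq]
    trivial
  induction ha using Submodule.span_induction with
  | mem x hx =>
    obtain ⟨q, rfl⟩ := hx
    exact h_of q.1 q.2
  | zero => simpa using h_smul 0 _ (h_of 1 1)
  | add x y _ _ hx hy => exact h_add x y hx hy
  | smul r x _ hx => exact h_smul r x hx

theorem mul_def (a b : DualAlg k F) : a * b = mulMap k F a b := rfl

theorem mulMap_of (s t : F.M) (u v : F.G) :
    mulMap k F (of k F s u) (of k F t v) = of k F s u * of k F t v := rfl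

theorem assoc_of (s t r : F.M) (u v w : F.G) :
    of k F s u * of k F t v * of k F r w = of k F s u * (of k F t v * of k F r w) := by
  classical
  have h0 : ∀ a : DualAlg k F, a * 0 = 0 := fun a => map_zero (mulMap k F a)
  have h0' : ∀ a : DualAlg k F, 0 * a = 0 := fun a => by simp [mul_def]
  rw [of_mul_of, of_mul_of]
  by_cases h2 : v = F.lact r w
  · subst h2
    by_cases h1 : u = F.lact t (F.lact r w)
    · simp [of_mul_of, h1, (F.act_mul_left t r w).1, mul_assoc]
    · simp [of_mul_of, h1, (F.act_mul_left t r w).1, h0']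
  · by_cases h1 : u = F.lact t v
    · simp [of_mul_of, h1, h2, h0]
    · simp [h1, h2, h0, h0']

theorem mulMap_assoc (a b c : DualAlg k F) : a * b * c = a * (b * c) := by
  simp only [mul_def]
  induction a using induction with
  | h_add a a' h h' => simp only [map_add, LinearMap.add_apply, h, h']
  | h_smul x a h => simp only [map_smul, LinearMap.smul_apply, h]
  | h_of s u =>
    induction b using induction with
    | h_add a a' h h' => simp only [map_add, LinearMap.add_apply, h, h']
    | h_smul x a h => simp only [map_smul, LinearMap.smul_apply, h]
    | h_of t v =>
      induction c using induction with
      | h_add a a' h h' => simp only [map_add, h, h']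
      | h_smul x a h => simp only [map_smul, h]
      | h_of r w => exact assoc_of k F s t r u v w

theorem one_mulMap [Finite X] (a : DualAlg k F) : 1 * a = a := by
  classical
  simp only [mul_def]
  induction a using induction with
  | h_add a a' h h' => simp only [map_add, h, h']
  | h_smul x a h => simp only [map_smul, h]
  | h_of s u =>
    simp [one_def, mulMap_of, of_mul_of]

theorem mulMap_one [Finite X] (a : DualAlg k F) : a * 1 = a := by
  classical
  simp only [mul_def]
  induction a using induction with
  | h_add a a' h h' => simp only [map_add, LinearMap.add_apply, h, h']
  | h_smul x a h => simp only [map_smul, LinearMap.smul_apply, h]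
  | h_of s u => simp [one_def, mulMap_of, of_mul_of, (F.act_one_left _).1]

noncomputable instance [Finite X] : Ring (DualAlg k F) :=
  { (inferInstance : AddCommGroup (DualAlg k F)),
    (inferInstance : Mul (DualAlg k F)), (inferInstance : One (DualAlg k F)) with
    left_distrib := fun a b c => map_add (mulMap k F a) b c
    right_distrib := fun a b c => by simp [mul_def]
    zero_mul := fun a => by simp [mul_def]
    mul_zero := fun a => map_zero (mulMap k F a)
    mul_assoc := mulMap_assoc k F
    one_mul := one_mulMap k F
    mul_one := mulMap_one k F }

noncomputable instance [Finite X] : Algebra k (DualAlg k F) :=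
  Algebra.ofModule (fun r a b => by simp [mul_def]) (fun r a b => by simp [mul_def])

noncomputable instance [Finite X] : Coalgebra k (DualAlg k F) where
  comul := comulMap k F
  counit := counitMap k F
  coassoc := hom_ext fun s u => by
    simp only [LinearMap.comp_apply, comulMap_of, map_sum, LinearMap.rTensor_tmul,
      LinearMap.lTensor_tmul, TensorProduct.sum_tmul, TensorProduct.tmul_sum,
      LinearEquiv.coe_coe, TensorProduct.assoc_tmul]
    rw [Finset.sum_comm]
    refine Finset.sum_congr rfl fun x _ => ?_
    refine Fintype.sum_equiv (Equiv.mulLeft x⁻¹) _ _ fun y => ?_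
    simp [← (F.act_mul_right _ _ _).2, mul_assoc]
  rTensor_counit_comp_comul := hom_ext fun s u => by
    simp only [LinearMap.comp_apply, comulMap_of, map_sum, LinearMap.rTensor_tmul,
      counitMap_of]
    rw [Finset.sum_eq_single 1]
    · simp [(F.act_one_right s).2]
    · intro x _ hx
      rw [if_neg hx, TensorProduct.zero_tmul]
    · simp
  lTensor_counit_comp_comul := hom_ext fun s u => by
    simp only [LinearMap.comp_apply, comulMap_of, map_sum, LinearMap.lTensor_tmul,
      counitMap_of]
    rw [Finset.sum_eq_single u]
    · simp
    · intro x _ hx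
      rw [if_neg (fun h => hx (inv_mul_eq_one.mp h)), TensorProduct.tmul_zero]
    · simp

theorem comul_of [Finite X] (s : F.M) (u : F.G) :
    Coalgebra.comul (R := k) (of k F s u) =
      ∑ x : F.G, of k F s x ⊗ₜ[k] of k F (F.ract s x) (x⁻¹ * u) :=
  comulMap_of k F s u

open Classical in
theorem counit_of [Finite X] (s : F.M) (u : F.G) :
    Coalgebra.counit (R := k) (of k F s u) = if u = 1 then 1 else 0 :=
  counitMap_of k F s u

theorem comul_one' [Finite X] :
    Coalgebra.comul (R := k) (1 : DualAlg k F) = 1 := by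
  rw [one_def, map_sum]
  simp only [comul_of, (F.act_one_left _).2]
  rw [Finset.sum_comm, Algebra.TensorProduct.one_def, one_def, TensorProduct.sum_tmul]
  simp only [TensorProduct.tmul_sum]
  refine Finset.sum_congr rfl fun x _ => ?_
  exact Fintype.sum_equiv (Equiv.mulLeft x⁻¹) _ _ fun a => rfl

theorem comul_mul_of [Finite X] (s t : F.M) (u v : F.G) :
    Coalgebra.comul (R := k) (of k F s u * of k F t v) =
      Coalgebra.comul (R := k) (of k F s u) * Coalgebra.comul (R := k) (of k F t v) := by
  classical
  rw [of_mul_of, comul_of, comul_of, Finset.sum_mul_sum, Finset.sum_comm]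
  simp only [Algebra.TensorProduct.tmul_mul_tmul, of_mul_of]
  have h : ∀ x : F.G, F.lact t x * F.lact (F.ract t x) (x⁻¹ * v) = F.lact t v := fun x => by
    rw [← (F.act_mul_right t x (x⁻¹ * v)).1, mul_inv_cancel_left]
  have key : ∀ x : F.G, (∑ y : F.G,
      (if y = F.lact t x then of k F (s * t) x else 0) ⊗ₜ[k]
      (if y⁻¹ * u = F.lact (F.ract t x) (x⁻¹ * v) then
        of k F (F.ract s y * F.ract t x) (x⁻¹ * v) else 0)) =
      if u = F.lact t v then of k F (s * t) x ⊗ₜ[k] of k F (F.ract (s * t) x) (x⁻¹ * v)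
      else 0 := fun x => by
    rw [Finset.sum_eq_single (F.lact t x)]
    · by_cases huv : u = F.lact t v
      · rw [if_pos huv, if_pos rfl,
          if_pos (inv_mul_eq_iff_eq_mul.mpr (huv.trans (h x).symm)), (F.act_mul_left s t x).2]
      · rw [if_neg huv, if_neg (fun hh => huv ((inv_mul_eq_iff_eq_mul.mp hh).trans (h x))),
          TensorProduct.tmul_zero]
    · intro y _ hy
      rw [if_neg hy, TensorProduct.zero_tmul]
    · simp
  rw [Finset.sum_congr rfl fun x _ => key x]
  by_cases huv : u = F.lact t v
  · simp only [if_pos huv, comul_of]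
  · simp [if_neg huv]

theorem counit_mul_of [Finite X] (s t : F.M) (u v : F.G) :
    Coalgebra.counit (R := k) (of k F s u * of k F t v) =
      Coalgebra.counit (R := k) (of k F s u) * Coalgebra.counit (R := k) (of k F t v) := by
  classical
  rw [of_mul_of, counit_of, counit_of]
  by_cases hv : v = 1
  · subst hv
    rw [(F.act_one_right t).1]
    by_cases hu : u = 1
    · simp [hu, counit_of]
    · simp [hu]
  · by_cases h : u = F.lact t v <;> simp [h, hv, counit_of]

noncomputable instance [Finite X] : Bialgebra k (DualAlg k F) where
  counit_one := by
    classical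
    simp [one_def, counit_of]
  mul_compr₂_counit := hom_ext fun s u => hom_ext fun t v => counit_mul_of k F s t u v
  comul_one := comul_one' k F
  mul_compr₂_comul := hom_ext fun s u => hom_ext fun t v => comul_mul_of k F s t u v

/-- The bicrossproduct Hopf algebra `H = kM ▷◂ k(G)`. -/
noncomputable instance [Finite X] : HopfAlgebra k (DualAlg k F) where
  antipode := antipodeMap k F
  mul_antipode_rTensor_comul := hom_ext fun s u => by
    classical
    simp only [LinearMap.comp_apply, comul_of, map_sum, LinearMap.rTensor_tmul,
      antipodeMap_of, LinearMap.mul'_apply, of_mul_of, counit_of]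
    have h : ∀ x : F.G, (F.lact s x)⁻¹ = F.lact (F.ract s x) (x⁻¹ * u) ↔ u = 1 := fun x => by
      rw [inv_eq_iff_mul_eq_one, ← (F.act_mul_right s x (x⁻¹ * u)).1, mul_inv_cancel_left,
        F.lact_eq_one_iff]
    simp only [h, inv_mul_cancel]
    by_cases hu : u = 1
    · subst hu
      simp only [if_true, Algebra.linearMap_apply, map_one, mul_one]
      rw [one_def]
      exact Fintype.sum_equiv (Equiv.inv F.G) _ _ fun x => rfl
    · simp [hu]
  mul_antipode_lTensor_comul := hom_ext fun s u => by
    classical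
    simp only [LinearMap.comp_apply, comul_of, map_sum, LinearMap.lTensor_tmul,
      antipodeMap_of, LinearMap.mul'_apply, of_mul_of, counit_of]
    have h : ∀ x : F.G, x = F.lact (F.ract (F.ract s x) (x⁻¹ * u))⁻¹
        (F.lact (F.ract s x) (x⁻¹ * u))⁻¹ ↔ u = 1 := fun x => by
      rw [(F.act_inv _ _).1]
      simp
    simp only [h]
    by_cases hu : u = 1
    · subst hu
      simp only [if_true, Algebra.linearMap_apply, map_one, mul_one]
      rw [one_def]
      refine Fintype.sum_equiv (F.lactEquiv s) _ _ fun x => ?_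
      have h1 := F.act_mul_right s x x⁻¹
      rw [mul_inv_cancel, (F.act_one_right s).1, (F.act_one_right s).2] at h1
      rw [← h1.2, mul_inv_cancel, inv_eq_of_mul_eq_one_left h1.1.symm]
      rfl
    · simp [hu]

end DualAlg

/-! ### The duality pairing of `A` and `H` -/

section Pairing

variable (F : Factorization X)

open Classical in
/-- The pairing `⟨δ_s ⊗ u, t ⊗ δ_v⟩ = δ_{s,t} δ_{u,v}`, identifying `H` with the dual of `A`. -/
noncomputable def pairing : CoordAlg k F →ₗ[k] DualAlg k F →ₗ[k] k :=
  (CoordAlg.basis k F).constr k fun p => (DualAlg.basis k F).constr k fun q =>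
    if p = q then 1 else 0

open Classical in
theorem pairing_of (s t : F.M) (u v : F.G) :
    pairing k F (CoordAlg.of k F s u) (DualAlg.of k F t v) = if s = t ∧ u = v then 1 else 0 := by
  simp [pairing, CoordAlg.of, DualAlg.of]

/-- The product of `A` is dual to the coproduct of `H`. -/
theorem pairing_mul_left [Finite X] (a b : CoordAlg k F) (h : DualAlg k F) :
    pairing k F (a * b) h = LinearMap.mul' k k
      (TensorProduct.map (pairing k F a) (pairing k F b) (Coalgebra.comul (R := k) h)) := by
  classical
  induction a using CoordAlg.induction with
  | h_add a a' h h' => simp [add_mul, h, h', TensorProduct.map_add_left]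
  | h_smul x a h => simp [h, TensorProduct.map_smul_left]
  | h_of s u =>
    induction b using CoordAlg.induction with
    | h_add a a' h h' => simp [mul_add, h, h', TensorProduct.map_add_right]
    | h_smul x a h => simp [h, TensorProduct.map_smul_right]
    | h_of t v =>
      induction h using DualAlg.induction with
      | h_add a a' h h' => simp [h, h']
      | h_smul x a h => simp [h]
      | h_of r w =>
        rw [DualAlg.comul_of, CoordAlg.of_mul_of, map_sum, map_sum]
        simp only [TensorProduct.map_tmul, LinearMap.mul'_apply, pairing_of]
        rw [Finset.sum_eq_single u]
        · by_cases h1 : s = r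
          · subst h1
            by_cases h2 : F.ract s u = t
            · simp [h2, pairing_of, eq_inv_mul_iff_mul_eq]
            · simp [h2, Ne.symm h2]
          · by_cases h2 : F.ract s u = t <;> simp [h1, h2, pairing_of]
        · intro x _ hx
          simp [Ne.symm hx]
        · simp

/-- The product of `H` is dual to the coproduct of `A`. -/
theorem pairing_mul_right [Finite X] (a : CoordAlg k F) (g h : DualAlg k F) :
    pairing k F a (g * h) = LinearMap.mul' k k
      (TensorProduct.map ((pairing k F).flip g) ((pairing k F).flip h)
        (Coalgebra.comul (R := k) a)) := by
  classical
  induction g using DualAlg.induction with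
  | h_add a a' h h' => simp [add_mul, h, h', TensorProduct.map_add_left]
  | h_smul x a h => simp [h, TensorProduct.map_smul_left]
  | h_of s u =>
    induction h using DualAlg.induction with
    | h_add a a' h h' => simp [mul_add, h, h', TensorProduct.map_add_right]
    | h_smul x a h => simp [h, TensorProduct.map_smul_right]
    | h_of t v =>
      induction a using CoordAlg.induction with
      | h_add a a' h h' => simp [h, h']
      | h_smul x a h => simp [h]
      | h_of r w =>
        rw [CoordAlg.comul_of, DualAlg.of_mul_of, map_sum, map_sum]
        simp only [TensorProduct.map_tmul, LinearMap.mul'_apply, LinearMap.flip_apply,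
          pairing_of]
        rw [Finset.sum_eq_single t]
        · by_cases h1 : w = v
          · subst h1
            by_cases h2 : u = F.lact t w
            · simp [h2, pairing_of, mul_inv_eq_iff_eq_mul]
            · simp [h2, Ne.symm h2]
          · by_cases h2 : u = F.lact t v <;> simp [h1, h2, pairing_of]
        · intro x _ hx
          simp [hx]
        · simp

end Pairing

/-! ### The canonical action of the quantum double `D(H)` on `H⁺`, and quantum tangent spaces -/

/-- The right quantum adjoint action `g ◁ h = S(h₁) g h₂` of a Hopf algebra on itself, as a
function of `h` and then of `g`. -/
noncomputable def rightAdjoint (H : Type*) [Ring H] [HopfAlgebra k H] : H →ₗ[k] H →ₗ[k] H :=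
  TensorProduct.lift (LinearMap.mk₂ k
    (fun x y => LinearMap.mulLeftRight k (HopfAlgebra.antipode k x, y))
    (fun x x' y => by ext; simp [add_mul])
    (fun c x y => by ext; simp)
    (fun x y y' => by ext; simp [mul_add])
    (fun c x y => by ext; simp)) ∘ₗ Coalgebra.comul

section Double

variable (F : Factorization X) [Finite X]

/-- The left action `a ▷ h = h₁ ⟨h₂, a⟩ - ⟨a, h⟩ 1` of `A = H*` on `H⁺ = ker ε`, given by the same
formula on all of `H`. -/
noncomputable def leftCoregular : CoordAlg k F →ₗ[k] DualAlg k F →ₗ[k] DualAlg k F :=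
  LinearMap.mk₂ k
    (fun a h => TensorProduct.rid k (DualAlg k F)
        ((pairing k F a).lTensor (DualAlg k F) (Coalgebra.comul h)) - pairing k F a h • 1)
    (fun a a' h => by simp [LinearMap.lTensor_add, add_smul]; abel)
    (fun c a h => by simp [LinearMap.lTensor_smul, smul_sub, mul_smul])
    (fun a h h' => by simp [add_smul]; abel)
    (fun c a h => by simp [smul_sub, mul_smul])

variable {k F}

/-- A quantum tangent space: a subspace of `H⁺ = ker ε` stable under the canonical action of the
quantum double `D(H)`, that is, under the right action of `H` and the left action of `A = H*`. -/
structure IsQuantumTangentSpace (L : Submodule k (DualAlg k F)) : Prop where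
  le_ker_counit : L ≤ LinearMap.ker (Coalgebra.counit (R := k) (A := DualAlg k F))
  rightAdjoint_mem : ∀ (h : DualAlg k F), ∀ l ∈ L, rightAdjoint k (DualAlg k F) h l ∈ L
  leftCoregular_mem : ∀ (a : CoordAlg k F), ∀ l ∈ L, leftCoregular k F a l ∈ L

variable (k F) in
/-- The vector space underlying the quantum double `D(H) = H*ᵒᵖ ⋈ H`, with `H* = A`. -/
abbrev Double : Type _ := CoordAlg k F ⊗[k] DualAlg k F

namespace IsQuantumTangentSpace

variable {L : Submodule k (DualAlg k F)} (hL : IsQuantumTangentSpace L)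

/-- The right action of `H` on a quantum tangent space. -/
noncomputable def rightH : DualAlg k F →ₗ[k] L →ₗ[k] L :=
  LinearMap.mk₂ k
    (fun h l => ⟨rightAdjoint k (DualAlg k F) h l, hL.rightAdjoint_mem h l l.2⟩)
    (fun h h' l => by ext1; simp) (fun c h l => by ext1; simp)
    (fun h l l' => by ext1; simp) (fun c h l => by ext1; simp)

/-- The left action of `A` on a quantum tangent space. -/
noncomputable def leftA : CoordAlg k F →ₗ[k] L →ₗ[k] L :=
  LinearMap.mk₂ k
    (fun a l => ⟨leftCoregular k F a l, hL.leftCoregular_mem a l l.2⟩)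
    (fun h h' l => by ext1; simp) (fun c h l => by ext1; simp)
    (fun h l l' => by ext1; simp) (fun c h l => by ext1; simp)

/-- The right action of `D(H)` on a quantum tangent space: `l ◁ (a ⊗ h) = (a ▷ l) ◁ h`. -/
noncomputable def rightDouble : Double k F →ₗ[k] L →ₗ[k] L :=
  TensorProduct.lift (LinearMap.mk₂ k (fun a h => hL.rightH h ∘ₗ hL.leftA a)
    (fun a a' h => by ext1 l; simp) (fun c a h => by ext1 l; simp)
    (fun a h h' => by ext1 l; simp) (fun c a h => by ext1 l; simp))

/-- The adjoint left action of `D(H)` on the invariant 1-forms `Λ¹ = L*`. -/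
noncomputable def doubleOnForms :
    Double k F →ₗ[k] Module.Dual k L →ₗ[k] Module.Dual k L :=
  Module.Dual.transpose ∘ₗ hL.rightDouble

end IsQuantumTangentSpace

variable (k F) in
/-- The universal R-matrix `∑ᵢ (αᵢ ⊗ 1) ⊗ (1 ⊗ βⁱ)` of `D(H)`, where `(αᵢ)` is a basis of `A` and
`(βⁱ)` is the dual basis of `H`. -/
noncomputable def universalR : Double k F ⊗[k] Double k F :=
  ∑ s : F.M, ∑ u : F.G,
    (CoordAlg.of k F s u ⊗ₜ[k] (1 : DualAlg k F)) ⊗ₜ[k]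
      ((1 : CoordAlg k F) ⊗ₜ[k] DualAlg.of k F s u)

/-- The braiding `Ψ : Λ¹ ⊗ Λ¹ → Λ¹ ⊗ Λ¹` induced by the action of the quantum double on the
invariant 1-forms: act with the universal R-matrix and flip the two factors. -/
noncomputable def braiding {L : Submodule k (DualAlg k F)} (hL : IsQuantumTangentSpace L) :
    Module.Dual k L ⊗[k] Module.Dual k L →ₗ[k] Module.Dual k L ⊗[k] Module.Dual k L :=
  (TensorProduct.comm k (Module.Dual k L) (Module.Dual k L)).toLinearMap ∘ₗ
    TensorProduct.homTensorHomMap (.id k) _ _ _ _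
      (TensorProduct.map hL.doubleOnForms hL.doubleOnForms (universalR k F))

end Double

/-! ### The `X`-crossed module `kX` -/

namespace Factorization

variable (F : Factorization X)

/-- The `X`-degree `‖vt‖ = v⁻¹ t⁻¹ v` of `vt ∈ X`, for `v ∈ G` and `t ∈ M`. -/
noncomputable def deg (x : X) : X := (F.gPart x : X)⁻¹ * (F.mPart x : X)⁻¹ * (F.gPart x : X)

/-- The right action of `X` on the set `X` given, for `v, u ∈ G` and `t, s ∈ M`, by
`vt ◁ us = (r ▷ vu) (r t r⁻¹)` with `r = s⁻¹ ◁ (vu)⁻¹`. -/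
noncomputable def tact (x y : X) : X :=
  let v := F.gPart x
  let t := F.mPart x
  let u := F.gPart y
  let s := F.mPart y
  let r := F.ract s⁻¹ (v * u)⁻¹
  (F.lact r (v * u) : X) * ((r * t * r⁻¹ : F.M) : X)

/-- The `M`-degree `⟨z⟩` in the factorization `z = ⟨z⟩⁻¹ |z|` of an element of `X = MG`. -/
noncomputable def mDeg (z : X) : F.M := F.mPart z⁻¹

/-- The `G`-degree `|z|` in the factorization `z = ⟨z⟩⁻¹ |z|` of an element of `X = MG`. -/
noncomputable def gDeg (z : X) : F.G := (F.gPart z⁻¹)⁻¹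

theorem mDeg_inv_mul_gDeg (z : X) : (F.mDeg z : X)⁻¹ * (F.gDeg z : X) = z := by
  have h := F.gPart_mul_mPart z⁻¹
  rw [mDeg, gDeg, Subgroup.coe_inv, ← mul_inv_rev, h, inv_inv]

end Factorization

section CrossedModule

variable (F : Factorization X)

/-- The right action of `y ∈ X` on the vector space `kX`. -/
noncomputable def xAct (y : X) : (X →₀ k) →ₗ[k] (X →₀ k) :=
  Finsupp.lmapDomain k k fun x => F.tact x y

/-- The space `J_z` of elements of `kX` that are homogeneous of `X`-degree `z`. -/
noncomputable def degSpace (z : X) : Submodule k (X →₀ k) :=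
  Finsupp.supported k k {x | F.deg x = z}

/-- The map `Π : kX → H⁺ ⊆ H`, `vt ↦ t ⊗ δ_v - ε(t ⊗ δ_v) 1`, for `v ∈ G` and `t ∈ M`. -/
noncomputable def projPlus [Finite X] : (X →₀ k) →ₗ[k] DualAlg k F :=
  Finsupp.linearCombination k fun x =>
    DualAlg.of k F (F.mPart x) (F.gPart x) -
      Coalgebra.counit (R := k) (DualAlg.of k F (F.mPart x) (F.gPart x)) • (1 : DualAlg k F)

end CrossedModule

/-! ### Irreducible quantum tangent spaces -/

/-- The datum classifying an irreducible bicovariant differential calculus on `A`: the conjugacy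
class of an element `z₀` of the image of the `X`-degree map, and an irreducible
subrepresentation `M₀` of `J_{z₀}` under the centralizer of `z₀`, which is not the trivial
representation if `z₀ = e`; together with a choice, for each conjugate `z` of `z₀`, of an element
`zbar z` of `X` with `z = (zbar z)⁻¹ z₀ (zbar z)`. -/
structure CalculusDatum (F : Factorization X) where
  /-- The chosen element of the conjugacy class. -/
  z₀ : X
  z₀_mem : z₀ ∈ Set.range F.deg
  /-- The representation of the centralizer of `z₀`. -/
  M₀ : Submodule k (X →₀ k)
  le_degSpace : M₀ ≤ degSpace k F z₀
  stable : ∀ y ∈ Subgroup.centralizer {z₀}, ∀ w ∈ M₀, xAct k F y w ∈ M₀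
  ne_bot : M₀ ≠ ⊥
  irreducible : ∀ N ≤ M₀,
    (∀ y ∈ Subgroup.centralizer {z₀}, ∀ w ∈ N, xAct k F y w ∈ N) → N = ⊥ ∨ N = M₀
  nontrivial : z₀ = 1 → ∃ y : X, ∃ w ∈ M₀, xAct k F y w ≠ w
  /-- The chosen conjugating elements. -/
  zbar : {z : X // IsConj z₀ z} → X
  zbar_spec : ∀ z, (zbar z)⁻¹ * z₀ * zbar z = z

namespace CalculusDatum

variable {k} {F : Factorization X} (D : CalculusDatum k F)

/-- The conjugacy class `C` of `z₀`. -/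
abbrev Cls : Type _ := {z : X // IsConj D.z₀ z}

/-- The subspace `∑_{z ∈ C} M₀ ◁ zbar z` of `kX`. -/
noncomputable def crossed : Submodule k (X →₀ k) :=
  ⨆ z : D.Cls, D.M₀.map (xAct k F (D.zbar z))

variable [Finite X]

/-- The quantum tangent space `L = Π(∑_{z ∈ C} M₀ ◁ zbar z)`. -/
noncomputable def tangent : Submodule k (DualAlg k F) := D.crossed.map (projPlus k F)

/-- The space of invariant 1-forms `Λ¹ = L*`. -/
abbrev Forms : Type _ := Module.Dual k D.tangent

/-- The identification of `∑_{z ∈ C} M₀ ◁ zbar z` with `L` by `Π`. -/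
noncomputable def tangentEquiv
    (hP : Function.Bijective ((projPlus k F).submoduleMap D.crossed)) :
    D.crossed ≃ₗ[k] D.tangent :=
  LinearEquiv.ofBijective ((projPlus k F).submoduleMap D.crossed) hP

/-- The right action `e * x` of `X` on `Λ¹`, adjoint to the left action `x * f = f ◁ x⁻¹`
on `L`. -/
noncomputable def star
    (hX : ∀ y : X, ∀ w ∈ D.crossed, xAct k F y w ∈ D.crossed)
    (hP : Function.Bijective ((projPlus k F).submoduleMap D.crossed))
    (e : D.Forms) (x : X) : D.Forms :=
  e ∘ₗ (D.tangentEquiv hP).toLinearMap ∘ₗ (xAct k F x⁻¹).restrict (hX x⁻¹) ∘ₗ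
    (D.tangentEquiv hP).symm.toLinearMap

end CalculusDatum

end Bicross

namespace Bicross

/-! ### The action and degree on the set `X` in terms of the two factorizations `X = GM` and `X =
MG`. -/

namespace Factorization

variable {X : Type*} [Group X] (F : Factorization X)

/-! The universal R-matrix is a sum over the dual bases `δ_s ⊗ u` of `A` and `s ⊗ δ_u` of `H`, and
on the forms `e_a` it collapses to one term, because each basis element acts on a homogeneous vector
either by zero or by an element of `X`.

Let `w` have degree `z = ⟨z⟩⁻¹|z|`. Up to `Π`, the element `δ_s ⊗ u` sends `w` to `w ◁ u⁻¹` if `s =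
⟨u z u⁻¹⟩` and to `0` otherwise (`leftCoregular_projPlus`); the element `s ⊗ δ_u` sends `w` to `w ◁
(s ◁ u)` if `s ▷ u = |z|` and to `0` otherwise (`rightAdjoint_projPlus`). In each condition the
degree of the source can be traded for that of the result: the first says that `s` is the `M`-degree
of `w ◁ u⁻¹`, the second that `u` is the `G`-degree of `w ◁ (s ◁ u)` (`lact_eq_gDeg_conj_iff`).
Since `e_a` only sees the block of degree `‖f_a‖`, composing it with these operators gives `e_a * u`
when `s = ⟨f_a⟩`, and `e_a * (s ◁ u)⁻¹` when `u = |f_a|`, and zero otherwise (`dualForm_comp_leftA`,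
`dualForm_comp_rightH`). In the braiding of `e_a ⊗ e_b` this forces `s = ⟨f_a⟩` and `u = |f_b|`.

The same two formulas give the stability of `L`. Injectivity of `Π` on `𝓜` comes from its kernel,
which is contained in the line through the invariant vector `∑_{u ∈ G} u`; irreducibility and
nontriviality keep this vector out of `𝓜` when `z₀ = e`, and its coefficient at the identity does so
otherwise (`sumG_notMem_crossed`). The basis property holds because the translates of `M₀` lie in
distinct degrees. -/

theorem gPart_mul (u : F.G) (s : F.M) : F.gPart ((u : X) * (s : X)) = u := (F.parts_eq rfl).1

theorem mPart_mul (u : F.G) (s : F.M) : F.mPart ((u : X) * (s : X)) = s := (F.parts_eq rfl).2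

theorem ext_parts {x y : X} (hg : F.gPart x = F.gPart y) (hm : F.mPart x = F.mPart y) :
    x = y := by
  rw [← F.gPart_mul_mPart x, ← F.gPart_mul_mPart y, hg, hm]

theorem degs_eq {z : X} {r : F.M} {v : F.G} (h : z = (r : X)⁻¹ * (v : X)) :
    F.mDeg z = r ∧ F.gDeg z = v := by
  have h1 := F.parts_eq (x := z⁻¹) (u := v⁻¹) (s := r) (by rw [h]; simp)
  exact ⟨h1.2, by rw [gDeg, h1.1, inv_inv]⟩

/-- Writing `v y = r⁻¹ v'` in `X = MG`, the action is `vt ↦ v' (r t r⁻¹)`: the `G`-part follows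
right translation on the cosets `M \ X`, and the `M`-part is conjugated by the resulting cocycle.
Everything below uses this description of `tact`. -/
theorem parts_tact (x y : X) :
    F.gPart (F.tact x y) = F.gDeg (F.gPart x * y) ∧
      F.mPart (F.tact x y) =
        F.mDeg (F.gPart x * y) * F.mPart x * (F.mDeg (F.gPart x * y))⁻¹ := by
  have hy := F.gPart_mul_mPart y
  have hr : F.ract (F.mPart y)⁻¹ (F.gPart x * F.gPart y)⁻¹ = F.mDeg (F.gPart x * y) := by
    rw [ract, mDeg]
    congr 1
    conv_rhs => rw [← hy]
    push_cast
    group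
  have hl : F.lact (F.mDeg (F.gPart x * y)) (F.gPart x * F.gPart y) =
      F.gDeg (F.gPart x * y) := by
    -- With `y = us`, the relation `r v y = v'` becomes `r (vu) = v' s⁻¹`, a factorization in `GM`.
    refine (F.act_eq (t := (F.mPart y)⁻¹) ?_).1
    have h := F.mDeg_inv_mul_gDeg (F.gPart x * y)
    rw [inv_mul_eq_iff_eq_mul] at h
    have h1 : y * (F.mPart y : X)⁻¹ = F.gPart y := mul_inv_eq_of_eq_mul hy.symm
    rw [h]
    push_cast
    simp only [mul_assoc, h1]
  rw [tact]
  simp only [hr, hl]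
  exact ⟨F.gPart_mul _ _, F.mPart_mul _ _⟩

theorem deg_mul (v : F.G) (t : F.M) :
    F.deg ((v : X) * (t : X)) = (v : X)⁻¹ * (t : X)⁻¹ * (v : X) := by
  rw [deg, gPart_mul, mPart_mul]

/-- The cocycle that conjugates the `M`-part cancels against the one relating the new `G`-part to `v
y`, so the degree is simply conjugated. -/
theorem deg_tact (x y : X) : F.deg (F.tact x y) = y⁻¹ * F.deg x * y := by
  have h := F.mDeg_inv_mul_gDeg (F.gPart x * y)
  rw [inv_mul_eq_iff_eq_mul] at h
  rw [deg, (F.parts_tact x y).1, (F.parts_tact x y).2, h, deg]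
  push_cast
  group

theorem tact_mul (x y y' : X) : F.tact x (y * y') = F.tact (F.tact x y) y' := by
  have h := F.mDeg_inv_mul_gDeg (F.gPart x * y)
  have h' := F.mDeg_inv_mul_gDeg (F.gDeg (F.gPart x * y) * y')
  -- The cocycle identity: the factor for `y y'` is the product of the factors of the two successive
  -- steps.
  have key : (F.gPart x : X) * (y * y') =
      ((F.mDeg (F.gDeg (F.gPart x * y) * y') * F.mDeg (F.gPart x * y) : F.M) : X)⁻¹ *
        (F.gDeg (F.gDeg (F.gPart x * y) * y') : X) := by
    push_cast
    rw [mul_inv_rev, mul_assoc, h', ← mul_assoc, ← mul_assoc, h]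
  have hk := F.degs_eq key
  apply F.ext_parts
  · rw [(F.parts_tact _ _).1, (F.parts_tact (F.tact x y) _).1, (F.parts_tact x y).1, hk.2]
  · rw [(F.parts_tact _ _).2, (F.parts_tact (F.tact x y) _).2, (F.parts_tact x y).1,
      (F.parts_tact x y).2, hk.1]
    group

theorem tact_one (x : X) : F.tact x 1 = x := by
  have hk := F.degs_eq (z := F.gPart x * 1) (r := 1) (v := F.gPart x) (by simp)
  apply F.ext_parts
  · rw [(F.parts_tact _ _).1, hk.2]
  · rw [(F.parts_tact _ _).2, hk.1]
    simp

theorem tact_injective (y : X) : Function.Injective fun x => F.tact x y := fun x x' h => by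
  have h1 := congrArg (fun w => F.tact w y⁻¹) h
  simpa only [← tact_mul, mul_inv_cancel, tact_one] using h1

theorem tact_coe (u : F.G) (y : X) : F.tact u y = F.gDeg (u * y) := by
  have hu := F.parts_eq (x := u) (u := u) (s := 1) (by simp)
  have h1 := F.parts_eq (x := F.gDeg (u * y)) (u := F.gDeg (u * y)) (s := 1) (by simp)
  apply F.ext_parts
  · rw [(F.parts_tact _ _).1, hu.1, h1.1]
  · rw [(F.parts_tact _ _).2, hu.1, hu.2, h1.2]
    simp

/-- From `v⁻¹ t⁻¹ v = (t v)⁻¹ v` with `t v = (t ▷ v)(t ◁ v)`. -/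
theorem degs_deg (x : X) :
    F.mDeg (F.deg x) = F.ract (F.mPart x) (F.gPart x) ∧
      F.gDeg (F.deg x) = (F.lact (F.mPart x) (F.gPart x))⁻¹ * F.gPart x :=
  F.degs_eq (by
    push_cast
    rw [← mul_assoc, ← mul_inv_rev, lact_mul_ract, mul_inv_rev, deg])

/-- Conjugating by `s ◁ u` a homogeneous degree with `G`-part `g` gives `G`-part `s ▷ u` exactly
when `u = g`. -/
theorem lact_eq_gDeg_conj_iff (s : F.M) (u : F.G) (z : X) :
    F.lact s u = F.gDeg ((F.ract s u : X) * z * (F.ract s u : X)⁻¹) ↔ u = F.gDeg z := by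
  have hz := F.mDeg_inv_mul_gDeg z
  have h := F.lact_mul_ract (F.ract s u) (F.gDeg z)⁻¹
  -- With `m = s ◁ u` and `g = |z|`, the `G`-part of `m z m⁻¹` is `(m ▷ g⁻¹)⁻¹`, so the equality to
  -- be decided reads `(s ▷ u)(m ▷ g⁻¹) = s ▷ (u g⁻¹) = 1`.
  have key : (F.ract s u : X) * z * (F.ract s u : X)⁻¹ =
      ((F.ract (F.ract s u) (F.gDeg z)⁻¹ * F.mDeg z * (F.ract s u)⁻¹ : F.M) : X)⁻¹ *
        (((F.lact (F.ract s u) (F.gDeg z)⁻¹)⁻¹ : F.G) : X) := by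
    push_cast
    rw [eq_mul_inv_of_mul_eq h]
    nth_rw 1 [← hz]
    push_cast
    group
  rw [(F.degs_eq key).2, eq_inv_iff_mul_eq_one, ← (F.act_mul_right s u _).1,
    F.lact_eq_one_iff, mul_inv_eq_one]

end Factorization

/-! ### The crossed module `kX`, the map `Π`, and the two actions on its image. -/

section CrossedModule

variable {k : Type*} [Field k] {X : Type*} [Group X] (F : Factorization X)

theorem xAct_single (y x : X) (c : k) :
    xAct k F y (Finsupp.single x c) = Finsupp.single (F.tact x y) c := by
  simp [xAct, Finsupp.mapDomain_single]

theorem xAct_mul (y y' : X) (w : X →₀ k) :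
    xAct k F (y * y') w = xAct k F y' (xAct k F y w) := by
  induction w using Finsupp.induction_linear with
  | zero => simp
  | add f g hf hg => simp only [map_add, hf, hg]
  | single x c => simp only [xAct_single, F.tact_mul]

theorem xAct_injective (y : X) : Function.Injective (xAct k F y) :=
  Finsupp.mapDomain_injective (F.tact_injective y)

theorem degSpace_induction {z : X} {p : (w : X →₀ k) → w ∈ degSpace k F z → Prop}
    (h0 : p 0 (zero_mem _))
    (h_add : ∀ f g hf hg, p f hf → p g hg → p (f + g) (add_mem hf hg))
    (h_single : ∀ x c (hx : F.deg x = z),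
      p (Finsupp.single x c) (Finsupp.single_mem_supported k c hx))
    {w : X →₀ k} (hw : w ∈ degSpace k F z) : p w hw := by
  have h : ∀ w, w ∈ degSpace k F z → ∃ hw, p w hw := by
    intro w hw
    rw [degSpace, Finsupp.supported_eq_span_single] at hw
    induction hw using Submodule.closure_induction with
    | zero => exact ⟨_, h0⟩
    | add f g _ _ hf hg => exact ⟨_, h_add f g _ _ hf.2 hg.2⟩
    | smul_mem c f hf =>
      obtain ⟨x, hx, rfl⟩ := hf
      rw [Finsupp.smul_single, smul_eq_mul, mul_one]
      exact ⟨_, h_single x c hx⟩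
  exact (h w hw).2

theorem apply_eq_zero {z : X} {w : X →₀ k} (hw : w ∈ degSpace k F z) {x : X}
    (hx : F.deg x ≠ z) : w x = 0 := by
  by_contra h
  exact hx (hw (Finsupp.mem_support_iff.mpr h))

theorem xAct_mem_degSpace {z : X} (y : X) {w : X →₀ k} (hw : w ∈ degSpace k F z) :
    xAct k F y w ∈ degSpace k F (y⁻¹ * z * y) := by
  induction hw using degSpace_induction with
  | h0 => simp
  | h_add f g _ _ hf hg => simpa using add_mem hf hg
  | h_single x c hx =>
    rw [xAct_single]
    exact Finsupp.single_mem_supported k c (by simp [F.deg_tact, hx])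

variable [Finite X]

theorem projPlus_single (x : X) (c : k) :
    projPlus k F (Finsupp.single x c) = c • (DualAlg.of k F (F.mPart x) (F.gPart x) -
      Coalgebra.counit (R := k) (DualAlg.of k F (F.mPart x) (F.gPart x)) •
        (1 : DualAlg k F)) := by
  simp [projPlus]

theorem counit_projPlus (w : X →₀ k) :
    Coalgebra.counit (R := k) (projPlus k F w) = 0 := by
  induction w using Finsupp.induction_linear with
  | zero => simp
  | add f g hf hg => simp [hf, hg]
  | single x c => simp [projPlus_single]

/-- This is the antipode axiom `S(h₁) h₂ = ε(h) 1`; it controls the unit correction in `Π`. -/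
theorem rightAdjoint_apply_one (h : DualAlg k F) :
    rightAdjoint k (DualAlg k F) h 1 = Coalgebra.counit (R := k) h • 1 := by
  have key : ∀ T : DualAlg k F ⊗[k] DualAlg k F,
      TensorProduct.lift (LinearMap.mk₂ k
        (fun x y => LinearMap.mulLeftRight k (HopfAlgebra.antipode k x, y))
        (fun x x' y => by ext; simp [add_mul])
        (fun c x y => by ext; simp)
        (fun x y y' => by ext; simp [mul_add])
        (fun c x y => by ext; simp)) T (1 : DualAlg k F) =
      LinearMap.mul' k (DualAlg k F)
        ((HopfAlgebra.antipode k).rTensor (DualAlg k F) T) := fun T => by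
    induction T with
    | zero => simp
    | add T T' h h' => simp only [map_add, LinearMap.add_apply, h, h']
    | tmul x y => simp
  rw [rightAdjoint, LinearMap.comp_apply, key, HopfAlgebra.mul_antipode_rTensor_comul_apply,
    Algebra.algebraMap_eq_smul_one]

theorem rightAdjoint_one (g : DualAlg k F) : rightAdjoint k (DualAlg k F) 1 g = g := by
  simp [rightAdjoint, Algebra.TensorProduct.one_def]

theorem pairing_one (h : DualAlg k F) : pairing k F 1 h = Coalgebra.counit (R := k) h := by
  classical
  induction h using DualAlg.induction with
  | h_add a a' h h' => simp only [map_add, h, h']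
  | h_smul x a h => simp only [map_smul, h]
  | h_of t v =>
    rw [CoordAlg.one_def, map_sum, LinearMap.sum_apply, DualAlg.counit_of]
    simp only [pairing_of, ite_and]
    simp [eq_comm]

theorem leftCoregular_apply_one (a : CoordAlg k F) : leftCoregular k F a 1 = 0 := by
  simp [leftCoregular, Algebra.TensorProduct.one_def]

/-- On all of `H` the unit of `A` acts by `h ↦ h - ε(h) 1`, so it is the identity only on the kernel
of the counit. -/
theorem leftCoregular_one {h : DualAlg k F} (hh : Coalgebra.counit (R := k) h = 0) :
    leftCoregular k F 1 h = h := by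
  have h1 : pairing k F 1 = Coalgebra.counit (R := k) (A := DualAlg k F) :=
    LinearMap.ext (pairing_one F)
  simp [leftCoregular, h1, hh]

open Classical in
-- In `S(h₁) g h₂` the delta function of the right-hand product selects one term of the coproduct,
-- and the delta function of the left-hand product turns into the condition on the degree of `x`.
theorem rightAdjoint_of (s : F.M) (u : F.G) (x : X) :
    rightAdjoint k (DualAlg k F) (DualAlg.of k F s u) (DualAlg.of k F (F.mPart x) (F.gPart x)) =
      if F.lact s u = F.gDeg (F.deg x) then
        DualAlg.of k F (F.mPart (F.tact x (F.ract s u))) (F.gPart (F.tact x (F.ract s u)))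
      else 0 := by
  set t := F.mPart x with ht
  set v := F.gPart x with hv
  rw [rightAdjoint, LinearMap.comp_apply, DualAlg.comul_of, map_sum, LinearMap.sum_apply]
  simp only [TensorProduct.lift.tmul, LinearMap.mk₂_apply, LinearMap.mulLeftRight_apply]
  have hS : ∀ y : F.G, HopfAlgebra.antipode k (DualAlg.of k F s y) =
      DualAlg.of k F (F.ract s y)⁻¹ (F.lact s y)⁻¹ := DualAlg.antipodeMap_of k F s
  have hu : ∀ y : F.G, F.lact s y * F.lact (F.ract s y) (y⁻¹ * u) = F.lact s u := fun y => by
    rw [← (F.act_mul_right s y (y⁻¹ * u)).1, mul_inv_cancel_left]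
  have hr : ∀ y : F.G, F.ract (F.ract s y) (y⁻¹ * u) = F.ract s u := fun y => by
    rw [← (F.act_mul_right s y (y⁻¹ * u)).2, mul_inv_cancel_left]
  -- The right-hand product requires `v = (s ◁ y) ▷ (y⁻¹ u)`, that is `(s ▷ y) v = s ▷ u`; `y₀` is
  -- the unique solution.
  set y₀ := F.lact s⁻¹ (F.lact s u * v⁻¹) with hy₀
  have h0 : F.lact s y₀ = F.lact s u * v⁻¹ := by
    rw [hy₀, ← (F.act_mul_left s s⁻¹ _).1, mul_inv_cancel, (F.act_one_left _).1]
  have h0' : F.lact (F.ract s y₀) (y₀⁻¹ * u) = v := by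
    have := hu y₀
    rw [h0] at this
    rw [mul_assoc, mul_eq_left, inv_mul_eq_one] at this
    exact this.symm
  rw [Finset.sum_eq_single y₀]
  · rw [hS, mul_assoc, DualAlg.of_mul_of, if_pos h0'.symm, DualAlg.of_mul_of,
      (F.act_mul_left _ _ _).1, h0', (F.degs_deg x).2, h0]
    have hiff : (F.lact s u * v⁻¹)⁻¹ = F.lact t v ↔ F.lact s u = (F.lact t v)⁻¹ * v := by
      rw [inv_eq_iff_eq_inv, mul_inv_eq_iff_eq_mul]
    -- Since `v (s ◁ u) = (s ◁ y₀)(y₀⁻¹ u)`, the surviving term is the basis element of `x ◁ (s ◁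
    -- u)`.
    have hd := F.degs_eq (z := (v : X) * (F.ract s u : X)) (r := (F.ract s y₀)⁻¹)
      (v := y₀⁻¹ * u) (by
        rw [← h0', ← hr y₀, F.lact_mul_ract]
        simp)
    rw [(F.parts_tact x _).1, (F.parts_tact x _).2, ← hv, ← ht, hd.1, hd.2]
    simp only [hiff, mul_assoc, inv_inv]
  · intro y _ hy
    rw [mul_assoc, DualAlg.of_mul_of, if_neg, mul_zero]
    intro h
    apply hy
    have h1 := hu y
    rw [← h, ← h0'] at h1
    have h2 := hu y₀
    have h3 : F.lact s y = F.lact s y₀ := mul_right_cancel (h1.trans h2.symm)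
    exact (F.lactEquiv s).injective h3
  · simp

open Classical in
theorem leftCoregular_of (s : F.M) (u : F.G) (x : X) :
    leftCoregular k F (CoordAlg.of k F s u) (DualAlg.of k F (F.mPart x) (F.gPart x)) =
      (if s = F.ract (F.mPart x) (F.gPart x * u⁻¹) then
        DualAlg.of k F (F.mPart x) (F.gPart x * u⁻¹) else 0) -
      (if s = F.mPart x ∧ u = F.gPart x then 1 else 0 : k) • 1 := by
  simp only [leftCoregular, LinearMap.mk₂_apply, pairing_of]
  congr 1
  -- Pairing the second tensor factor with `δ_s ⊗ u` forces `y⁻¹ v = u`.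
  rw [DualAlg.comul_of, map_sum, map_sum, Finset.sum_eq_single (F.gPart x * u⁻¹)]
  · simp only [LinearMap.lTensor_tmul, pairing_of, TensorProduct.rid_tmul]
    simp [ite_smul]
  · intro y _ hy
    simp only [LinearMap.lTensor_tmul, pairing_of, TensorProduct.rid_tmul]
    rw [if_neg, zero_smul]
    rintro ⟨_, rfl⟩
    exact hy (by simp)
  · simp

open Classical in
-- By linearity this reduces to `rightAdjoint_of`; what remains is that the multiples of the unit
-- subtracted by `Π` match before and after the action.
theorem rightAdjoint_projPlus (s : F.M) (u : F.G) {z : X} {w : X →₀ k}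
    (hw : w ∈ degSpace k F z) :
    rightAdjoint k (DualAlg k F) (DualAlg.of k F s u) (projPlus k F w) =
      if F.lact s u = F.gDeg z then projPlus k F (xAct k F (F.ract s u) w) else 0 := by
  induction hw using degSpace_induction with
  | h0 => simp
  | h_add f g _ _ hf hg => split_ifs at hf hg ⊢ <;> simp [hf, hg]
  | h_single x c hx =>
    rw [projPlus_single, map_smul, map_sub, map_smul, rightAdjoint_of, rightAdjoint_apply_one,
      xAct_single, projPlus_single, hx]
    have h1 : F.gPart x = 1 → F.gDeg z = 1 := fun h => by
      rw [← hx, (F.degs_deg x).2, h, (F.act_one_right _).1]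
      simp
    -- The counit of the transformed vector is nonzero exactly when those of the vector and of `s ⊗
    -- δ_u` both are.
    have h2 : F.lact s u = F.gDeg z →
        (F.gPart (F.tact x (F.ract s u)) = 1 ↔ F.gPart x = 1 ∧ u = 1) := fun h => by
      rw [(F.parts_tact _ _).1]
      have hz := F.mDeg_inv_mul_gDeg ((F.gPart x : X) * (F.ract s u : X))
      constructor
      · intro h3
        rw [h3, Subgroup.coe_one, mul_one] at hz
        have h4 := F.parts_eq (u := F.gPart x) (s := F.ract s u) (x := _) hz.symm
        have h5 := F.parts_eq (u := 1)
          (s := (F.mDeg ((F.gPart x : X) * (F.ract s u : X)))⁻¹) (x := _) (by simp; rfl)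
        have h6 : F.gPart x = 1 := by
          rw [← h4.1, ← h5.1]
        exact ⟨h6, by rwa [h1 h6, F.lact_eq_one_iff] at h⟩
      · rintro ⟨h3, _⟩
        refine (F.degs_eq (r := (F.ract s u)⁻¹) ?_).2
        simp [h3]
    by_cases h : F.lact s u = F.gDeg z
    · simp only [if_pos h, DualAlg.counit_of, h2 h]
      by_cases h3 : F.gPart x = 1 <;> by_cases h4 : u = 1 <;> simp [h3, h4]
    · simp only [if_neg h, DualAlg.counit_of]
      by_cases h3 : F.gPart x = 1 <;> by_cases h4 : u = 1 <;> simp [h3, h4]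
      -- The only case with a leftover unit has `v = u = e`, where `s ▷ u = e = |z|` contradicts the
      -- failed condition.
      exact absurd (by rw [h4, (F.act_one_right s).1, h1 h3]) h

open Classical in
-- Acting by `u⁻¹ ∈ G` leaves the `M`-part unchanged, and the condition on `s` is that it be the
-- `M`-degree of the result. The term `-⟨a, h⟩ 1` of the action supplies the unit correction of the
-- result.
theorem leftCoregular_projPlus (s : F.M) (u : F.G) {z : X} {w : X →₀ k}
    (hw : w ∈ degSpace k F z) :
    leftCoregular k F (CoordAlg.of k F s u) (projPlus k F w) =
      if s = F.mDeg ((u : X) * z * (u : X)⁻¹) then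
        projPlus k F (xAct k F (u : X)⁻¹ w) else 0 := by
  induction hw using degSpace_induction with
  | h0 => simp
  | h_add f g _ _ hf hg => split_ifs at hf hg ⊢ <;> simp [hf, hg]
  | h_single x c hx =>
    have hd := F.degs_eq (z := (F.gPart x : X) * (u : X)⁻¹) (r := 1)
      (v := F.gPart x * u⁻¹) (by simp)
    have hg : F.gPart (F.tact x (u : X)⁻¹) = F.gPart x * u⁻¹ := by
      rw [(F.parts_tact _ _).1, hd.2]
    have hm : F.mPart (F.tact x (u : X)⁻¹) = F.mPart x := by
      rw [(F.parts_tact _ _).2, hd.1]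
      simp
    have hz : F.mDeg ((u : X) * z * (u : X)⁻¹) = F.ract (F.mPart x) (F.gPart x * u⁻¹) := by
      have h1 := F.deg_tact x (u : X)⁻¹
      rw [hx, inv_inv] at h1
      rw [← h1, (F.degs_deg _).1, hg, hm]
    rw [projPlus_single, map_smul, map_sub, map_smul, leftCoregular_of,
      leftCoregular_apply_one, xAct_single, projPlus_single, hg, hm, hz, DualAlg.counit_of]
    by_cases h : u = F.gPart x
    · subst h
      simp [(F.act_one_right _).2, DualAlg.counit_of]
      split_ifs <;> simp
    · have h' : F.gPart x * u⁻¹ ≠ 1 := fun h1 => h (mul_inv_eq_one.mp h1).symm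
      simp [h, h', DualAlg.counit_of]

/-- The sum of the elements of `G`, an `X`-invariant element of `kX`. -/
noncomputable def sumG : X →₀ k := ∑ u : F.G, Finsupp.single (u : X) 1

/-- On `G` the action is that of `X` on `M \ X`, so `y` permutes the summands. -/
theorem xAct_sumG (y : X) : xAct k F y (sumG F) = sumG F := by
  simp only [sumG, map_sum, xAct_single, F.tact_coe]
  refine Fintype.sum_bijective (fun u : F.G => F.gDeg (u * y)) ?_ _ _ fun u => rfl
  refine Finite.injective_iff_bijective.mp fun u u' h => ?_
  have h1 : F.tact u y = F.tact u' y := by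
    rw [F.tact_coe, F.tact_coe]
    exact congrArg _ h
  exact Subtype.ext (F.tact_injective y h1)

theorem sumG_apply_one : (sumG F : X →₀ k) 1 = 1 := by
  classical
  rw [sumG, Finsupp.finsetSum_apply, Finset.sum_eq_single 1]
  · simp
  · intro u _ hu
    rw [Finsupp.single_apply, if_neg]
    simpa using hu
  · simp

/-- `Π` is the injective identification of `kX` with `H` followed by `h ↦ h - ε(h) 1`, whose kernel
lies in the line of the unit; the unit `∑ e ⊗ δ_u` corresponds to `sumG`. -/
theorem exists_eq_smul_sumG {w : X →₀ k} (hw : projPlus k F w = 0) :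
    ∃ c : k, w = c • sumG F := by
  let φ : (X →₀ k) →ₗ[k] DualAlg k F :=
    Finsupp.linearCombination k fun x => DualAlg.of k F (F.mPart x) (F.gPart x)
  have hφ : Function.Injective φ := by
    have h1 := (DualAlg.basis k F).linearIndependent.comp
      (fun x : X => (F.mPart x, F.gPart x)) fun x y h =>
        F.ext_parts (congrArg Prod.snd h) (congrArg Prod.fst h)
    exact h1
  have h2 : ∀ w, projPlus k F w = φ w - Coalgebra.counit (R := k) (φ w) • 1 := fun w => by
    induction w using Finsupp.induction_linear with
    | zero => simp
    | add f g hf hg => simp only [map_add, hf, hg, add_smul]; abel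
    | single x c => simp [projPlus_single, φ, smul_sub, mul_smul]
  have h3 : φ (sumG F) = 1 := by
    rw [sumG, map_sum, DualAlg.one_def]
    refine Finset.sum_congr rfl fun u _ => ?_
    have hu := F.parts_eq (x := u) (u := u) (s := 1) (by simp)
    simp [φ, hu.1, hu.2]
  refine ⟨Coalgebra.counit (R := k) (φ w), hφ ?_⟩
  rw [h2, sub_eq_zero] at hw
  rw [map_smul, h3]
  exact hw

end CrossedModule
end Bicross

namespace Bicross

/-! ### The subspace generated by `M₀`, its tangent space and its homogeneous basis. -/

namespace CalculusDatum

variable {k : Type*} [Field k] {X : Type*} [Group X] {F : Factorization X}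
  (D : CalculusDatum k F)

theorem map_le_crossed (z : D.Cls) : D.M₀.map (xAct k F (D.zbar z)) ≤ D.crossed :=
  le_iSup (fun z : D.Cls => D.M₀.map (xAct k F (D.zbar z))) z

theorem map_le_degSpace (z : D.Cls) :
    D.M₀.map (xAct k F (D.zbar z)) ≤ degSpace k F (z : X) := by
  rintro _ ⟨m, hm, rfl⟩
  have h := xAct_mem_degSpace F (D.zbar z) (D.le_degSpace hm)
  rwa [D.zbar_spec] at h

/-- The conjugate `y⁻¹ z y` of an element `z` of the conjugacy class. -/
def conj (z : D.Cls) (y : X) : D.Cls :=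
  ⟨y⁻¹ * z * y, z.2.trans (isConj_iff.mpr ⟨y⁻¹, by simp⟩)⟩

/-- The usual argument for induced representations: `X` permutes the translates of `M₀`, up to
elements of the centralizer. -/
theorem xAct_mem_map (z : D.Cls) (y : X) {w : X →₀ k}
    (hw : w ∈ D.M₀.map (xAct k F (D.zbar z))) :
    xAct k F y w ∈ D.M₀.map (xAct k F (D.zbar (D.conj z y))) := by
  obtain ⟨m, hm, rfl⟩ := hw
  have h1 := D.zbar_spec z
  have h2 := D.zbar_spec (D.conj z y)
  -- Both `zbar z * y` and `zbar (y⁻¹ z y)` conjugate `z₀` to `y⁻¹ z y`, so their quotient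
  -- centralizes `z₀`.
  refine ⟨xAct k F (D.zbar z * y * (D.zbar (D.conj z y))⁻¹) m, D.stable _ ?_ m hm, ?_⟩
  · rw [Subgroup.mem_centralizer_singleton_iff]
    have h3 : (D.conj z y : X) = y⁻¹ * z * y := rfl
    rw [h3, ← h1] at h2
    have h4 : D.z₀ * (D.zbar (D.conj z y) * y⁻¹ * (D.zbar z)⁻¹) =
        (D.zbar (D.conj z y) * y⁻¹ * (D.zbar z)⁻¹) * D.z₀ := by
      rw [mul_assoc, inv_mul_eq_iff_eq_mul] at h2
      calc _ = D.z₀ * D.zbar (D.conj z y) * y⁻¹ * (D.zbar z)⁻¹ := by group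
        _ = _ := by rw [h2]; group
    have h5 := Commute.inv_right h4
    have h6 : (D.zbar (D.conj z y) * y⁻¹ * (D.zbar z)⁻¹)⁻¹ =
        D.zbar z * y * (D.zbar (D.conj z y))⁻¹ := by group
    rw [h6] at h5
    exact h5.eq.symm
  · rw [← xAct_mul, ← xAct_mul]
    congr 2
    group

theorem xAct_mem_crossed (y : X) {w : X →₀ k} (hw : w ∈ D.crossed) :
    xAct k F y w ∈ D.crossed := by
  induction hw using Submodule.iSup_induction' with
  | mem z w hw => exact D.map_le_crossed _ (D.xAct_mem_map z y hw)
  | zero => simp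
  | add f g _ _ hf hg => simpa using add_mem hf hg

theorem apply_eq_zero_of_mem_crossed {w : X →₀ k} (hw : w ∈ D.crossed) {x : X}
    (hx : ¬ IsConj D.z₀ (F.deg x)) : w x = 0 := by
  induction hw using Submodule.iSup_induction' with
  | mem z w hw =>
    refine apply_eq_zero F (D.map_le_degSpace z hw) ?_
    exact fun h => hx (h ▸ z.2)
  | zero => rfl
  | add f g _ _ hf hg => rw [Finsupp.add_apply, hf, hg, add_zero]

theorem crossed_le_of_eq_one (h1 : D.z₀ = 1) : D.crossed ≤ D.M₀ := by
  refine iSup_le fun z => ?_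
  rintro _ ⟨m, hm, rfl⟩
  refine D.stable _ ?_ m hm
  rw [Subgroup.mem_centralizer_singleton_iff, h1]
  simp

section Finite

variable [Finite X]

/-- If `z₀ = e`, the centralizer is all of `X`, and an invariant vector in `M₀` would span it by
irreducibility, making it trivial. If `z₀ ≠ e`, elements of `crossed` vanish at the identity, which
has degree `e`, while `sumG` has coefficient one there. -/
theorem sumG_notMem_crossed : sumG F ∉ D.crossed := by
  intro h
  have hs := sumG_apply_one (k := k) F
  by_cases h1 : D.z₀ = 1
  · have hM := D.crossed_le_of_eq_one h1 h
    rcases D.irreducible (Submodule.span k {sumG F}) (by simpa using hM) (by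
      intro y _ w hw
      obtain ⟨c, rfl⟩ := Submodule.mem_span_singleton.mp hw
      rwa [map_smul, xAct_sumG]) with h2 | h2
    · rw [Submodule.span_singleton_eq_bot] at h2
      simp [h2] at hs
    · obtain ⟨y, w, hw, hne⟩ := D.nontrivial h1
      rw [← h2] at hw
      obtain ⟨c, rfl⟩ := Submodule.mem_span_singleton.mp hw
      exact hne (by rw [map_smul, xAct_sumG])
  · have h2 : F.deg 1 = 1 := by
      have h3 := F.deg_mul 1 1
      simpa using h3
    rw [D.apply_eq_zero_of_mem_crossed h] at hs
    · exact zero_ne_one hs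
    · rw [h2, isConj_comm, isConj_one_right]
      exact h1

theorem bijective_submoduleMap :
    Function.Bijective ((projPlus k F).submoduleMap D.crossed) := by
  refine ⟨?_, LinearMap.submoduleMap_surjective _ _⟩
  rw [injective_iff_map_eq_zero]
  rintro ⟨w, hw⟩ h
  have h0 : projPlus k F w = 0 := congrArg Subtype.val h
  obtain ⟨c, rfl⟩ := exists_eq_smul_sumG F h0
  by_cases hc : c = 0
  · simp [hc]
  · exact absurd ((Submodule.smul_mem_iff _ hc).mp hw) D.sumG_notMem_crossed

/-- Checked on basis elements of `H` and `A` and on one homogeneous block at a time, where the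
actions become zero or elements of `X`. -/
theorem isQuantumTangentSpace : IsQuantumTangentSpace D.tangent where
  le_ker_counit := by
    rintro _ ⟨w, _, rfl⟩
    exact counit_projPlus F w
  rightAdjoint_mem h l hl := by
    classical
    obtain ⟨w, hw, rfl⟩ := hl
    induction h using DualAlg.induction with
    | h_add a a' h h' => simpa using add_mem h h'
    | h_smul c a h => simpa using Submodule.smul_mem _ c h
    | h_of s u =>
      induction hw using Submodule.iSup_induction' with
      | mem z w hw =>
        rw [rightAdjoint_projPlus F s u (D.map_le_degSpace z hw)]
        split_ifs
        · exact Submodule.mem_map_of_mem (D.xAct_mem_crossed _ (D.map_le_crossed z hw))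
        · exact zero_mem _
      | zero => simp
      | add f g _ _ hf hg => simpa using add_mem hf hg
  leftCoregular_mem a l hl := by
    classical
    obtain ⟨w, hw, rfl⟩ := hl
    induction a using CoordAlg.induction with
    | h_add a a' h h' => simpa using add_mem h h'
    | h_smul c a h => simpa using Submodule.smul_mem _ c h
    | h_of s u =>
      induction hw using Submodule.iSup_induction' with
      | mem z w hw =>
        rw [leftCoregular_projPlus F s u (D.map_le_degSpace z hw)]
        split_ifs
        · exact Submodule.mem_map_of_mem (D.xAct_mem_crossed _ (D.map_le_crossed z hw))
        · exact zero_mem _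
      | zero => simp
      | add f g _ _ hf hg => simpa using add_mem hf hg

end Finite

section Basis

variable {ι : Type*} (f : Module.Basis ι k D.M₀)

/-- The map `m ↦ m ◁ zbar z` from `M₀` to the sum of its translates. -/
noncomputable def translate (z : D.Cls) : D.M₀ →ₗ[k] D.crossed :=
  (xAct k F (D.zbar z) ∘ₗ D.M₀.subtype).codRestrict D.crossed fun m =>
    D.map_le_crossed z (Submodule.mem_map_of_mem m.2)

/-- The vectors `f_{iz} = f_i ◁ zbar z`. -/
noncomputable def crossedVec (a : ι × D.Cls) : D.crossed := D.translate a.2 (f a.1)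

theorem crossedVec_mem (a : ι × D.Cls) :
    (D.crossedVec f a : X →₀ k) ∈ D.M₀.map (xAct k F (D.zbar a.2)) :=
  Submodule.mem_map_of_mem (f a.1).2

theorem crossedVec_mem_degSpace (a : ι × D.Cls) :
    (D.crossedVec f a : X →₀ k) ∈ degSpace k F a.2 :=
  D.map_le_degSpace a.2 (D.crossedVec_mem f a)

theorem linearIndependent_crossedVec [Finite X] [Finite ι] : LinearIndependent k (D.crossedVec f) := by
  classical
  have := Fintype.ofFinite ι
  have := Fintype.ofFinite D.Cls
  refine LinearIndependent.of_comp D.crossed.subtype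
    (Fintype.linearIndependent_iff.mpr fun c h0 a => ?_)
  simp only [Function.comp_apply, Submodule.subtype_apply] at h0
  -- Evaluating the relation at points of degree `a.2` isolates the block of `a`; injectivity of the
  -- action of `zbar a.2` then carries it back to `M₀`.
  have h1 : ∑ i, c (i, a.2) • (D.crossedVec f (i, a.2) : X →₀ k) = 0 := by
    ext x
    rw [Finsupp.finsetSum_apply, Finsupp.zero_apply]
    by_cases hx : F.deg x = a.2
    · have h2 := DFunLike.congr_fun h0 x
      rw [Finsupp.finsetSum_apply, Fintype.sum_prod_type_right, Finset.sum_eq_single a.2] at h2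
      · exact h2
      · intro z _ hz
        refine Finset.sum_eq_zero fun i _ => ?_
        rw [Finsupp.smul_apply, apply_eq_zero F (D.crossedVec_mem_degSpace f (i, z)), smul_zero]
        rw [hx]
        exact fun h => hz (Subtype.ext h).symm
      · simp
    · refine Finset.sum_eq_zero fun i _ => ?_
      rw [Finsupp.smul_apply, apply_eq_zero F (D.crossedVec_mem_degSpace f (i, a.2)) hx,
        smul_zero]
  have h2 : ∑ i, c (i, a.2) • f i = 0 := by
    apply Subtype.ext
    apply xAct_injective F (D.zbar a.2)
    simpa [crossedVec, translate] using h1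
  have h3 := f.repr_sum_self fun i => c (i, a.2)
  rw [h2, map_zero] at h3
  exact (congrFun h3 a.1).symm

theorem span_crossedVec : ⊤ ≤ Submodule.span k (Set.range (D.crossedVec f)) := by
  have h1 : D.crossed ≤ (Submodule.span k (Set.range (D.crossedVec f))).map
      D.crossed.subtype := by
    refine iSup_le fun z => ?_
    rintro _ ⟨m, hm, rfl⟩
    refine ⟨D.translate z ⟨m, hm⟩, ?_, rfl⟩
    have h2 : (⊤ : Submodule k D.M₀) ≤
        (Submodule.span k (Set.range (D.crossedVec f))).comap (D.translate z) := by
      rw [← f.span_eq, Submodule.span_le]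
      rintro _ ⟨i, rfl⟩
      exact Submodule.subset_span ⟨(i, z), rfl⟩
    exact h2 (x := (⟨m, hm⟩ : D.M₀)) Submodule.mem_top
  rintro ⟨w, hw⟩ -
  obtain ⟨w', hw', rfl⟩ := h1 hw
  exact hw'

variable [Finite X] [Finite ι]

/-- The basis `f_{iz} = f_i ◁ zbar z`. -/
noncomputable def crossedBasis : Module.Basis (ι × D.Cls) k D.crossed :=
  Module.Basis.mk (D.linearIndependent_crossedVec f) (D.span_crossedVec f)

theorem crossedBasis_apply (a : ι × D.Cls) : D.crossedBasis f a = D.crossedVec f a :=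
  Module.Basis.mk_apply _ _ a

theorem coord_eq_zero (a : ι × D.Cls) {z : D.Cls} (hz : z ≠ a.2) {w : D.crossed}
    (hw : (w : X →₀ k) ∈ D.M₀.map (xAct k F (D.zbar z))) :
    (D.crossedBasis f).coord a w = 0 := by
  classical
  have h : (D.crossedBasis f).coord a ∘ₗ D.translate z = 0 := f.ext fun i => by
    have h1 : D.translate z (f i) = D.crossedBasis f (i, z) :=
      (D.crossedBasis_apply f (i, z)).symm
    have h2 : (i, z) ≠ a := by
      rintro rfl
      exact hz rfl
    simp [h1, h2]
  obtain ⟨m, hm, hmw⟩ := hw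
  have h3 : w = D.translate z ⟨m, hm⟩ := Subtype.ext hmw.symm
  rw [h3]
  exact LinearMap.congr_fun h _

variable (hX : ∀ y : X, ∀ w ∈ D.crossed, xAct k F y w ∈ D.crossed)
  (hP : Function.Bijective ((projPlus k F).submoduleMap D.crossed))
  (hL : IsQuantumTangentSpace D.tangent)

/-- The basis of invariant 1-forms dual to `f_{iz}`. -/
noncomputable def dualForm (a : ι × D.Cls) : D.Forms :=
  ((D.crossedBasis f).map (D.tangentEquiv hP)).coord a

theorem dualForm_tangentEquiv (a : ι × D.Cls) (w : D.crossed) :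
    D.dualForm f hP a (D.tangentEquiv hP w) = (D.crossedBasis f).coord a w := by
  simp [dualForm]

theorem star_tangentEquiv (e : D.Forms) (x : X) (w : D.crossed) :
    D.star hX hP e x (D.tangentEquiv hP w) =
      e (D.tangentEquiv hP ⟨xAct k F x⁻¹ w, hX x⁻¹ w w.2⟩) := by
  simp only [star, LinearMap.comp_apply, LinearEquiv.coe_coe, LinearEquiv.symm_apply_apply]
  rfl

open Classical in
theorem leftA_tangentEquiv (s : F.M) (u : F.G) {z : X} {w : D.crossed}
    (hw : (w : X →₀ k) ∈ degSpace k F z) :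
    hL.leftA (CoordAlg.of k F s u) (D.tangentEquiv hP w) =
      if s = F.mDeg ((u : X) * z * (u : X)⁻¹) then
        D.tangentEquiv hP ⟨xAct k F (u : X)⁻¹ w, hX _ w w.2⟩ else 0 := by
  apply Subtype.ext
  refine (leftCoregular_projPlus F s u hw).trans ?_
  split_ifs <;> rfl

open Classical in
theorem rightH_tangentEquiv (s : F.M) (u : F.G) {z : X} {w : D.crossed}
    (hw : (w : X →₀ k) ∈ degSpace k F z) :
    hL.rightH (DualAlg.of k F s u) (D.tangentEquiv hP w) =
      if F.lact s u = F.gDeg z then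
        D.tangentEquiv hP ⟨xAct k F (F.ract s u) w, hX _ w w.2⟩ else 0 := by
  apply Subtype.ext
  refine (rightAdjoint_projPlus F s u hw).trans ?_
  split_ifs <;> rfl

open Classical in
-- `e_a` kills the image of `f_c` unless `u ‖f_c‖ u⁻¹ = ‖f_a‖`. In that case the condition on `s` no
-- longer depends on `c`; otherwise both sides vanish.
theorem dualForm_comp_leftA (a : ι × D.Cls) (s : F.M) (u : F.G) :
    D.dualForm f hP a ∘ₗ hL.leftA (CoordAlg.of k F s u) =
      if s = F.mDeg a.2 then D.star hX hP (D.dualForm f hP a) (u : X) else 0 := by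
  refine ((D.crossedBasis f).map (D.tangentEquiv hP)).ext fun c => ?_
  have hc := D.crossedVec_mem f c
  rw [Module.Basis.map_apply, crossedBasis_apply, LinearMap.comp_apply,
    D.leftA_tangentEquiv hX hP hL s u (D.crossedVec_mem_degSpace f c)]
  have h1 : ((D.conj c.2 (u : X)⁻¹ : D.Cls) : X) = u * c.2 * (u : X)⁻¹ := by simp [conj]
  rw [← h1]
  by_cases h : D.conj c.2 (u : X)⁻¹ = a.2
  · rw [h]
    split_ifs
    · rw [star_tangentEquiv]
    · simp
  · have h2 : D.dualForm f hP a (D.tangentEquiv hP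
        ⟨xAct k F (u : X)⁻¹ (D.crossedVec f c), hX _ _ (D.crossedVec f c).2⟩) = 0 := by
      rw [dualForm_tangentEquiv]
      exact D.coord_eq_zero f a h (D.xAct_mem_map c.2 _ hc)
    rw [apply_ite (D.dualForm f hP a), h2, map_zero, ite_self]
    split_ifs
    · rw [star_tangentEquiv, h2]
    · simp

open Classical in
-- As for the action of `A`: only those `f_c` with `‖f_c‖ = (s ◁ u) ‖f_a‖ (s ◁ u)⁻¹` contribute, and
-- for them `lact_eq_gDeg_conj_iff` turns `s ▷ u = |f_c|` into a condition on `a` alone.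
theorem dualForm_comp_rightH (a : ι × D.Cls) (s : F.M) (u : F.G) :
    D.dualForm f hP a ∘ₗ hL.rightH (DualAlg.of k F s u) =
      if u = F.gDeg a.2 then
        D.star hX hP (D.dualForm f hP a) ((F.ract s u)⁻¹ : F.M) else 0 := by
  refine ((D.crossedBasis f).map (D.tangentEquiv hP)).ext fun c => ?_
  have hc := D.crossedVec_mem f c
  rw [Module.Basis.map_apply, crossedBasis_apply, LinearMap.comp_apply,
    D.rightH_tangentEquiv hX hP hL s u (D.crossedVec_mem_degSpace f c)]
  have h1 : (c.2 : X) = F.ract s u * (D.conj c.2 (F.ract s u : X) : D.Cls) *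
      (F.ract s u : X)⁻¹ := by
    simp [conj, mul_assoc]
  have hiff := F.lact_eq_gDeg_conj_iff s u (D.conj c.2 (F.ract s u : X) : D.Cls)
  rw [← h1] at hiff
  simp only [hiff]
  by_cases h : D.conj c.2 (F.ract s u : X) = a.2
  · rw [h]
    split_ifs
    · rw [star_tangentEquiv]
      simp
    · simp
  · have h2 : D.dualForm f hP a (D.tangentEquiv hP
        ⟨xAct k F (F.ract s u) (D.crossedVec f c), hX _ _ (D.crossedVec f c).2⟩) = 0 := by
      rw [dualForm_tangentEquiv]
      exact D.coord_eq_zero f a h (D.xAct_mem_map c.2 _ hc)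
    rw [apply_ite (D.dualForm f hP a), h2, map_zero, ite_self]
    split_ifs
    · rw [star_tangentEquiv]
      simpa using h2.symm
    · simp

end Basis

end CalculusDatum

/-! ### The braiding as an explicit sum over dual bases, and its evaluation. -/

section Braiding

variable {k : Type*} [Field k] {X : Type*} [Group X] [Finite X] {F : Factorization X}
  {L : Submodule k (DualAlg k F)} (hL : IsQuantumTangentSpace L)

theorem doubleOnForms_tmul_one (a : CoordAlg k F) (x : Module.Dual k L) :
    hL.doubleOnForms (a ⊗ₜ[k] 1) x = x ∘ₗ hL.leftA a := by
  ext l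
  change x (hL.rightH 1 (hL.leftA a l)) = x (hL.leftA a l)
  congr 1
  exact Subtype.ext (rightAdjoint_one F _)

theorem doubleOnForms_one_tmul (h : DualAlg k F) (x : Module.Dual k L) :
    hL.doubleOnForms (1 ⊗ₜ[k] h) x = x ∘ₗ hL.rightH h := by
  ext l
  change x (hL.rightH h (hL.leftA 1 l)) = x (hL.rightH h l)
  congr 2
  exact Subtype.ext (leftCoregular_one F (hL.le_ker_counit l.2))

theorem braiding_tmul (x y : Module.Dual k L) :
    braiding hL (x ⊗ₜ[k] y) = ∑ s : F.M, ∑ u : F.G,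
      (y ∘ₗ hL.rightH (DualAlg.of k F s u)) ⊗ₜ[k] (x ∘ₗ hL.leftA (CoordAlg.of k F s u)) := by
  simp only [braiding, universalR, map_sum, LinearMap.comp_apply, LinearMap.sum_apply,
    TensorProduct.map_tmul, TensorProduct.homTensorHomMap_apply, doubleOnForms_tmul_one,
    doubleOnForms_one_tmul, LinearEquiv.coe_coe, TensorProduct.comm_tmul]

end Braiding

end Bicross

theorem mainTheorem5 {k : Type*} [Field k] [CharZero k] {X : Type*} [Group X] [Finite X]
    (F : Bicross.Factorization X) (D : Bicross.CalculusDatum k F)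
    {ι : Type*} [Finite ι] (f : Module.Basis ι k D.M₀) :
    ∃ (hX : ∀ y : X, ∀ w ∈ D.crossed, Bicross.xAct k F y w ∈ D.crossed)
      (hP : Function.Bijective ((Bicross.projPlus k F).submoduleMap D.crossed))
      (hL : Bicross.IsQuantumTangentSpace D.tangent)
      (b : Module.Basis (ι × D.Cls) k D.crossed),
      (∀ a, (b a : X →₀ k) = Bicross.xAct k F (D.zbar a.2) (f a.1)) ∧
      (∀ a, (b a : X →₀ k) ∈ Bicross.degSpace k F a.2) ∧
      ∀ a a' : ι × D.Cls,
        let e : ι × D.Cls → D.Forms := fun c => (b.map (D.tangentEquiv hP)).coord c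
        Bicross.braiding hL (e a ⊗ₜ[k] e a') =
          D.star hX hP (e a') ((F.ract (F.mDeg a.2) (F.gDeg a'.2))⁻¹ : F.M) ⊗ₜ[k]
            D.star hX hP (e a) (F.gDeg a'.2 : F.G) := by
  classical
  refine ⟨fun y w hw => D.xAct_mem_crossed y hw, D.bijective_submoduleMap,
    D.isQuantumTangentSpace, D.crossedBasis f, fun a => ?_, fun a => ?_, fun a a' => ?_⟩
  · rw [D.crossedBasis_apply]
    rfl
  · rw [D.crossedBasis_apply]
    exact D.crossedVec_mem_degSpace f a
  · change Bicross.braiding _ (D.dualForm f _ a ⊗ₜ[k] D.dualForm f _ a') =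
      D.star _ _ (D.dualForm f _ a') _ ⊗ₜ[k] D.star _ _ (D.dualForm f _ a) _
    -- The factor from `e a` fixes `s` through the action of `A`, and the factor from `e a'` fixes
    -- `u` through the action of `H`.
    rw [Bicross.braiding_tmul, Finset.sum_eq_single (F.mDeg a.2),
      Finset.sum_eq_single (F.gDeg a'.2)]
    · rw [D.dualForm_comp_rightH f (fun y w hw => D.xAct_mem_crossed y hw),
        D.dualForm_comp_leftA f (fun y w hw => D.xAct_mem_crossed y hw), if_pos rfl, if_pos rfl]
    · intro u _ hu
      rw [D.dualForm_comp_rightH f (fun y w hw => D.xAct_mem_crossed y hw), if_neg hu,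
        TensorProduct.zero_tmul]
    · simp
    · intro s _ hs
      refine Finset.sum_eq_zero fun u _ => ?_
      rw [D.dualForm_comp_leftA f (fun y w hw => D.xAct_mem_crossed y hw), if_neg hs,
        TensorProduct.tmul_zero]
    · simp
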